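/- Let $\mathbb F$ be a field and let $\varphi$ be a 3SAT formula with $n$ variables $x_1,\dots,x_n$ and $m$ clauses of three literals each (repetitions allowed), having $S$ satisfying assignments. Put $$X=\begin{pmatrix}1&0\\0&-1\end{pmatrix},\quad Y=\begin{pmatrix}0&-1\\-1&0\end{pmatrix},\quad Z=\begin{pmatrix}0&-1\\1&0\end{pmatrix},\quad J_2=\begin{pmatrix}0&1\\1&0\end{pmatrix}$$ in $M_2(\mathbb F)$. All graphs below are finite directed multigraphs with edge weights in $M_2(\mathbb F)$; all weights are $I_2$ unless stated otherwise, and in the adjacency matrix the weights of parallel edges are added. The graph $H_\varphi$ is built as follows. *Variable gadgets.* For each variable $x_k$ take a start vertex $s_k$ and an end vertex $t_k$, a middle edge $(t_k,s_k)$, and, for each of the two literals $\ell\in\{x_k,\overline{x_k}\}$, a path from $s_k$ to $t_k$ (the side of $\ell$) whose edges are called external; their number is the least odd number that is at least the number of instances of $\ell$ in $\varphi$. Every interior vertex of each path carries a self-loop (so each side has an even number of self-loops). *Clause gadgets.* For each clause take vertices $v_0,v_1,v_2,v_3$, three external edges $(v_0,v_1),(v_1,v_2),(v_2,v_0)$,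 one for each literal of the clause, a second edge $(v_0,v_1)$, an edge $(v_1,v_0)$ of weight $-I_2$, and the edges $(v_i,v_3)$ and $(v_3,v_i)$ for $i=0,1,2$. *Sign normalization.* If $n+m$ is odd, subdivide the middle edge of one variable gadget by one new vertex. The resulting graph is $H^0_\varphi$. *XOR gadgets.* To each literal instance assign an external edge on the side of that literal in its variable gadget, distinct instances getting distinct edges. For each of the $3m$ literal instances, let $(u,u')$ and $(v,v')$ be (in either order) its external edge in the clause gadget and the external edge assigned to it in the variable gadget; delete both edges and add new vertices $a,b,c,d$ with edges $(u,a),(c,u'),(v,c),(a,v')$ of weight $I_2$ and with edges among $a,b,c,d$ given by the adjacency matrix (zero entries meaning no edge) $$\begin{pmatrix}0&-X&-Y&Z\\0&X&2Y&Z\\0&3X&0&Z\\I_2&X&Y&-Z\end{pmatrix}.$$ The resulting graph is $H_\varphi$. Number its vertices so that the vertices of $H^0_\varphi$ come first, in any order, followed by the XOR gadgets in any order, the vertices $a,b,c,d$ of each gadget being consecutive and in this order. Let $\det(H_\varphi)$ be the Cayley determinant $\sum_{\sigma\in S_N}\mathrm{sgn}(\sigma)\,h_{1,\sigma(1)}h_{2,\sigma(2)}\cdots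 h_{N,\sigma(N)}$ of the adjacency matrix $(h_{ij})$ of $H_\varphi$. Then, for all choices left open in the construction, there are $a,b\in\mathbb F$ with $\det(H_\varphi)=aI_2+bJ_2$ and $a+b=4^{3m}S$ (as elements of $\mathbb F$). -/

import Mathlib

/-- The Cayley determinant (products taken in row order) of a square matrix over a possibly
noncommutative ring. -/
def cayleyDet {A : Type*} [Ring A] {N : ℕ} (M : Matrix (Fin N) (Fin N) A) : A :=
  ∑ σ : Equiv.Perm (Fin N), Equiv.Perm.sign σ • (List.ofFn fun i => M i (σ i)).prod

/-- A finite directed multigraph on vertices `V` with edge set `E` and edge weights in `A`. -/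
structure WGraph (V E A : Type*) where
  src : E → V
  tgt : E → V
  weight : E → A

/-- The adjacency matrix; the weights of parallel edges are added. -/
def WGraph.adjacency {V E A : Type*} [DecidableEq V] [Fintype E] [AddCommMonoid A]
    (G : WGraph V E A) : Matrix V V A :=
  Matrix.of fun u v => ∑ e : E, if G.src e = u ∧ G.tgt e = v then G.weight e else 0

/-! ### The matrix weights and the XOR gadget -/

abbrev M2 (F : Type*) := Matrix (Fin 2) (Fin 2) F

def matX (F : Type*) [Field F] : M2 F := !![1, 0; 0, -1]
def matY (F : Type*) [Field F] : M2 F := !![0, -1; -1, 0]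
def matZ (F : Type*) [Field F] : M2 F := !![0, -1; 1, 0]
def matJ (F : Type*) [Field F] : M2 F := !![0, 1; 1, 0]

/-- Weights of the edges among the vertices `a, b, c, d` (numbered `0, 1, 2, 3`) of an XOR
gadget; a zero entry means that there is no edge. -/
def xorWeight (F : Type*) [Field F] : Matrix (Fin 4) (Fin 4) (M2 F) :=
  !![0, -matX F, -matY F, matZ F;
     0, matX F, 2 * matY F, matZ F;
     0, 3 * matX F, 0, matZ F;
     1, matX F, matY F, -matZ F]

/-- The edges that remain when, for each `p : P`, the edges `f p` and `g p` are removed. -/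
abbrev KeptEdge {E P : Type*} (f g : P → E) := {e : E // ∀ p, f p ≠ e ∧ g p ≠ e}

/-- The four edges joining an XOR gadget to the rest of the graph, when the gadget
replaces the edges `(u, u')` and `(v, v')`. -/
inductive XorLink
  | uToA
  | cToU
  | vToC
  | aToV
  deriving DecidableEq

instance : Fintype XorLink :=
  ⟨{.uToA, .cToU, .vToC, .aToV}, by intro x; cases x <;> decide⟩

/-- For every `p : P`, replace the two edges `f p = (u, u')` and `g p = (v, v')` by an XOR gadget
on four new vertices `a, b, c, d`: the new edges are `(u, a)`, `(c, u')`, `(v, c)`, `(a, v')`,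
each of weight `1`, and the edges inside the gadget. -/
def WGraph.xorReplace {V E P F : Type*} [Field F] (G : WGraph V E (M2 F)) (f g : P → E) :
    WGraph (V ⊕ P × Fin 4) (KeptEdge f g ⊕ P × XorLink ⊕ P × Fin 4 × Fin 4) (M2 F) where
  src
    | .inl e => .inl (G.src e.1)
    | .inr (.inl (p, .uToA)) => .inl (G.src (f p))
    | .inr (.inl (p, .cToU)) => .inr (p, 2)
    | .inr (.inl (p, .vToC)) => .inl (G.src (g p))
    | .inr (.inl (p, .aToV)) => .inr (p, 0)
    | .inr (.inr (p, i, _)) => .inr (p, i)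
  tgt
    | .inl e => .inl (G.tgt e.1)
    | .inr (.inl (p, .uToA)) => .inr (p, 0)
    | .inr (.inl (p, .cToU)) => .inl (G.tgt (f p))
    | .inr (.inl (p, .vToC)) => .inr (p, 2)
    | .inr (.inl (p, .aToV)) => .inl (G.tgt (g p))
    | .inr (.inr (p, _, j)) => .inr (p, j)
  weight
    | .inl e => G.weight e.1
    | .inr (.inl _) => 1
    | .inr (.inr (_, i, j)) => xorWeight F i j

/-! ### Formulas -/

/-- A 3SAT formula with `m` clauses of three literals each, on `n` variables. The literal
`(k, true)` is the variable `x_k` and `(k, false)` is its negation. -/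
abbrev ThreeSAT (n m : ℕ) := Fin m → Fin 3 → Fin n × Bool

namespace ThreeSAT

variable {n m : ℕ}

/-- The number of satisfying assignments. -/
def numSat (φ : ThreeSAT n m) : ℕ :=
  Fintype.card {α : Fin n → Bool // ∀ j, ∃ i, α (φ j i).1 = (φ j i).2}

/-- The number of instances of a literal in the formula. -/
def occ (φ : ThreeSAT n m) (l : Fin n × Bool) : ℕ :=
  Fintype.card {p : Fin m × Fin 3 // φ p.1 p.2 = l}

/-- The number of vertices carrying a self-loop on the side of a variable gadget belonging to the
literal `l`. The side is a path of external edges through these vertices, so it has one external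
edge more than that: the least odd number that is at least `occ φ l`. -/
def sideLen (φ : ThreeSAT n m) (l : Fin n × Bool) : ℕ := 2 * (φ.occ l / 2)

/-- Vertices of the preliminary graph. Variable gadget `k` has a start vertex, an end vertex and
the self-loop vertices of its two sides; clause gadget `j` has three outer vertices `0, 1, 2`
and a centre `3`. There is one additional vertex exactly if `n + m` is odd. -/
inductive BaseVertex (φ : ThreeSAT n m) : Type
  | start (k : Fin n)
  | finish (k : Fin n)
  | inner (l : Fin n × Bool) (i : Fin (φ.sideLen l))
  | clause (j : Fin m) (c : Fin 4)
  | extra (z : Fin ((n + m) % 2))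
  deriving DecidableEq, Fintype

/-- Edges of the preliminary graph. -/
inductive BaseEdge (φ : ThreeSAT n m) : Type
  | varExt (l : Fin n × Bool) (i : Fin (φ.sideLen l + 1))
  | loop (l : Fin n × Bool) (i : Fin (φ.sideLen l))
  | middle (k : Fin n)
  | extra (z : Fin ((n + m) % 2))
  | clauseExt (j : Fin m) (i : Fin 3)
  | clauseForth (j : Fin m)
  | clauseBack (j : Fin m)
  | toCentre (j : Fin m) (i : Fin 3)
  | fromCentre (j : Fin m) (i : Fin 3)
  deriving DecidableEq, Fintype

/-- The `i`-th vertex on the path from start to end along the side of the literal `l`. -/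
def pathVertex (φ : ThreeSAT n m) (l : Fin n × Bool) : ℕ → BaseVertex φ
  | 0 => .start l.1
  | i + 1 => if h : i < φ.sideLen l then .inner l ⟨i, h⟩ else .finish l.1

/-- The choices left open in the construction: the variable gadgets' external edges (one for each
literal occurrence, distinct ones for distinct occurrences, on the side of the literal that
occurs), which edge of a pair plays the role of `(u, u')` in the XOR gadget, and the variable
gadget whose middle edge receives the additional vertex, if there is one. -/
structure Layout (φ : ThreeSAT n m) where
  slot : (p : Fin m × Fin 3) → Fin (φ.sideLen (φ p.1 p.2) + 1)
  slot_injective : Function.Injective fun p : Fin m × Fin 3 =>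
    (⟨φ p.1 p.2, slot p⟩ : Σ l : Fin n × Bool, Fin (φ.sideLen l + 1))
  clauseFirst : Fin m × Fin 3 → Bool
  extraAt : Fin ((n + m) % 2) → Fin n

/-- The preliminary graph: disjoint variable gadgets and clause gadgets. All weights are `1`, except
for one edge of weight `-1` in each clause gadget. -/
def baseGraph (F : Type*) [Field F] (φ : ThreeSAT n m) (L : Layout φ) :
    WGraph (BaseVertex φ) (BaseEdge φ) (M2 F) where
  src
    | .varExt l i => φ.pathVertex l i
    | .loop l i => .inner l i
    | .middle k => .finish k
    | .extra z => .extra z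
    | .clauseExt j i => .clause j i.castSucc
    | .clauseForth j => .clause j 0
    | .clauseBack j => .clause j 1
    | .toCentre j i => .clause j i.castSucc
    | .fromCentre j _ => .clause j 3
  tgt
    | .varExt l i => φ.pathVertex l (i + 1)
    | .loop l i => .inner l i
    | .middle k => if h : ∃ z, L.extraAt z = k then .extra ⟨0, h.elim fun z _ => z.pos⟩ else .start k
    | .extra z => .start (L.extraAt z)
    | .clauseExt j i => .clause j (i + 1).castSucc
    | .clauseForth j => .clause j 1
    | .clauseBack j => .clause j 0
    | .toCentre j _ => .clause j 3
    | .fromCentre j i => .clause j i.castSucc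
  weight
    | .clauseBack _ => -1
    | _ => 1

/-- The first edge `(u, u')` of the pair of edges replaced for the occurrence `p`. -/
def firstEdge (φ : ThreeSAT n m) (L : Layout φ) (p : Fin m × Fin 3) : BaseEdge φ :=
  if L.clauseFirst p then .clauseExt p.1 p.2 else .varExt (φ p.1 p.2) (L.slot p)

/-- The second edge `(v, v')` of the pair of edges replaced for the occurrence `p`. -/
def secondEdge (φ : ThreeSAT n m) (L : Layout φ) (p : Fin m × Fin 3) : BaseEdge φ :=
  if L.clauseFirst p then .varExt (φ p.1 p.2) (L.slot p) else .clauseExt p.1 p.2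

/-- Vertices of the final graph. -/
abbrev HVertex (φ : ThreeSAT n m) := BaseVertex φ ⊕ (Fin m × Fin 3) × Fin 4

/-- The final graph: for each literal occurrence, its clause external edge and the chosen
external edge of the variable gadget are replaced by an XOR gadget. -/
def hGraph (F : Type*) [Field F] (φ : ThreeSAT n m) (L : Layout φ) :
    WGraph (HVertex φ)
      (KeptEdge (φ.firstEdge L) (φ.secondEdge L) ⊕ (Fin m × Fin 3) × XorLink ⊕
        (Fin m × Fin 3) × Fin 4 × Fin 4) (M2 F) :=
  (φ.baseGraph F L).xorReplace (φ.firstEdge L) (φ.secondEdge L)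

/-- Admissible numberings of the vertices of the final graph: the vertices of the preliminary
graph come first, and the vertices `a, b, c, d` of each XOR gadget are numbered consecutively, in
this order. -/
structure IsNumbering (φ : ThreeSAT n m) {N : ℕ} (e : HVertex φ ≃ Fin N) : Prop where
  base_lt : ∀ v q, e (.inl v) < e (.inr q)
  consecutive : ∀ p i, (e (.inr (p, i)) : ℕ) = e (.inr (p, 0)) + i

end ThreeSAT

/-! Only the rows of the XOR gadgets carry noncommuting weights, and they come last in consecutive
blocks of four. So each term of the Cayley determinant is a scalar times an ordered product of one
block weight per gadget. Fix a permutation up to the distribution of its columns among the four rows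
of one gadget. The columns of `b` and `d` have nonzero entries in these rows only, so a finite
alternating sum remains, depending on two further columns. A computation over the integers
(`alternating_portProdInt_cols`) shows that this sum does not change if the gadget is replaced by
two alternatives: a single link from `a` to `u'` with weight `-4I`, or a single link from `c` to
`v'` with weight `-4J`, all other vertices of the gadget having self-loops. Thus exactly one of the
two replaced edges is used. The other blocks are constant on the cosets involved, so the gadgets can
be exchanged one at a time in spite of noncommutativity (`sum_replace_gadgets`).

Afterwards everything lies in the commutative algebra spanned by `I` and `J`, where `J² = I`, and `a
+ b` is the image of `aI + bJ` under the character `J ↦ 1` (`IsJSum`). Under it both alternatives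
weigh `-4`. Expanding the product over the gadgets gives one ordinary determinant for each choice of
an edge per literal instance, with the chosen edges subdivided. Removing a subdivision costs a sign
and leaves the condition that the edge be used (`det_linkMatrix`). This yields `4^(3m)` times the
sum, over all choices, of the signed cycle covers of the preliminary graph that use the chosen edges
and avoid the rejected ones (`isJSum_cayleyDet_xorReplace`).

Those determinants factor over the gadgets. A cover of a variable gadget is a cycle through one
side, of even length, with the self-loops of the other side (`det_variable`). A clause gadget
contributes `-1` unless all its external edges are forced, and then `0`
(`det_clauseMatrix_coverWeight`). The signs `(-1)^(n+m)` are cancelled by the additional vertex. A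
choice therefore counts the truth assignments that induce it, provided every clause has a true
literal (`sum_det_baseMatrix`). -/

/-! ### The local identity of the XOR gadget, over the integers. -/

/-- The columns that can meet the rows `a, b, c, d` of an XOR gadget, with integer weights: the
columns `a, b, c, d`, the columns of `u'` and `v'`, and a zero column. -/
def portColumnInt : Fin 7 → Fin 4 → Matrix (Fin 2) (Fin 2) ℤ :=
  ![![0, 0, 0, 1],
    ![!![-1, 0; 0, 1], !![1, 0; 0, -1], !![3, 0; 0, -3], !![1, 0; 0, -1]],
    ![!![0, 1; 1, 0], !![0, -2; -2, 0], 0, !![0, -1; -1, 0]],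
    ![!![0, -1; 1, 0], !![0, -1; 1, 0], !![0, -1; 1, 0], !![0, 1; -1, 0]],
    ![0, 0, 1, 0], ![1, 0, 0, 0], 0]

/-- Weight of the choice of columns `t` in the rows of an XOR gadget. -/
def portProdInt (t : Fin 4 → Fin 7) : Matrix (Fin 2) (Fin 2) ℤ :=
  portColumnInt (t 0) 0 * portColumnInt (t 1) 1 * portColumnInt (t 2) 2 * portColumnInt (t 3) 3

/-- Weight of the same choice after the gadget has been replaced by two single links. -/
def linkProdInt (t : Fin 4 → Fin 7) : Matrix (Fin 2) (Fin 2) ℤ :=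
  (if t 0 = 4 ∧ t 1 = 1 ∧ t 2 = 2 ∧ t 3 = 3 then !![-4, 0; 0, -4] else 0) +
  (if t 0 = 0 ∧ t 1 = 1 ∧ t 2 = 5 ∧ t 3 = 3 then !![0, -4; -4, 0] else 0)

/-- A finite check; integer entries make it decidable and valid in every field. The zero column may
occur twice because it stands for all columns foreign to the gadget. The common value is nonzero
only for the pairs `{c, u'}` and `{a, v'}`: one edge is entered and left, the other untouched. -/
theorem alternating_portProdInt_cols : ∀ x ∈ [0, 2, 4, 5, 6], ∀ y ∈ [0, 2, 4, 5, 6],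
    (x ≠ y ∨ x = 6) →
    ∑ π : Equiv.Perm (Fin 4), Equiv.Perm.sign π • portProdInt (![x, 1, y, 3] ∘ π) =
      ∑ π : Equiv.Perm (Fin 4), Equiv.Perm.sign π • linkProdInt (![x, 1, y, 3] ∘ π) := by
  decide +kernel

/-- Both sides are alternating in the columns, so those of `b` and `d` may be moved to positions 1
and 3, which leaves the finite check. -/
theorem alternating_portProdInt (t : Fin 4 → Fin 7) (h1 : ∃ i, t i = 1) (h3 : ∃ i, t i = 3)
    (hinj : ∀ i j, t i = t j → i = j ∨ t i = 6) :
    ∑ π : Equiv.Perm (Fin 4), Equiv.Perm.sign π • portProdInt (t ∘ π) =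
      ∑ π : Equiv.Perm (Fin 4), Equiv.Perm.sign π • linkProdInt (t ∘ π) := by
  obtain ⟨i, hi⟩ := h1
  obtain ⟨j, hj⟩ := h3
  have hij : i ≠ j := by rintro rfl; rw [hi] at hj; exact absurd hj (by decide)
  obtain ⟨ρ, h1, h3⟩ : ∃ ρ : Equiv.Perm (Fin 4), ρ 1 = i ∧ ρ 3 = j := by
    clear hi hj; revert i j; decide +kernel
  have ht : t ∘ ρ = ![t (ρ 0), 1, t (ρ 2), 3] := by
    funext k; fin_cases k <;> simp [h1, h3, hi, hj]
  have key := alternating_portProdInt_cols (t (ρ 0)) ?_ (t (ρ 2)) ?_ ?_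
  · rw [← ht] at key
    have shift : ∀ f : (Fin 4 → Fin 7) → Matrix (Fin 2) (Fin 2) ℤ,
        ∑ π : Equiv.Perm (Fin 4), Equiv.Perm.sign π • f (t ∘ π) =
          Equiv.Perm.sign ρ • ∑ π : Equiv.Perm (Fin 4), Equiv.Perm.sign π • f ((t ∘ ρ) ∘ π) := by
      intro f
      rw [← Equiv.sum_comp (Equiv.mulLeft ρ), Finset.smul_sum]
      refine Finset.sum_congr rfl fun π _ => ?_
      simp [mul_smul, Function.comp_assoc]
    rw [shift, shift, key]
  · have e1 : t (ρ 0) ≠ 1 := fun h => by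
      rcases hinj (ρ 0) i (h.trans hi.symm) with h' | h'
      · rw [← h1] at h'; exact absurd (ρ.injective h') (by decide)
      · rw [h] at h'; exact absurd h' (by decide)
    have e3 : t (ρ 0) ≠ 3 := fun h => by
      rcases hinj (ρ 0) j (h.trans hj.symm) with h' | h'
      · rw [← h3] at h'; exact absurd (ρ.injective h') (by decide)
      · rw [h] at h'; exact absurd h' (by decide)
    generalize t (ρ 0) = x at e1 e3
    revert x; decide
  · have e1 : t (ρ 2) ≠ 1 := fun h => by
      rcases hinj (ρ 2) i (h.trans hi.symm) with h' | h'
      · rw [← h1] at h'; exact absurd (ρ.injective h') (by decide)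
      · rw [h] at h'; exact absurd h' (by decide)
    have e3 : t (ρ 2) ≠ 3 := fun h => by
      rcases hinj (ρ 2) j (h.trans hj.symm) with h' | h'
      · rw [← h3] at h'; exact absurd (ρ.injective h') (by decide)
      · rw [h] at h'; exact absurd h' (by decide)
    generalize t (ρ 2) = x at e1 e3
    revert x; decide
  · by_contra! h
    rcases hinj _ _ h.1 with h' | h'
    · exact absurd (ρ.injective h') (by decide)
    · exact h.2 h'

theorem portProdInt_eq_zero {t : Fin 4 → Fin 7} {i : Fin 4} (h : t i = 6) :
    portProdInt t = 0 := by
  have h6 : portColumnInt 6 = 0 := rfl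
  fin_cases i <;> simp_all [portProdInt]

theorem linkProdInt_eq_zero {t : Fin 4 → Fin 7} {i : Fin 4} (h : t i = 6) :
    linkProdInt t = 0 := by
  fin_cases i <;> simp_all [linkProdInt]

/-! ### Replacing the gadgets one at a time. -/

/-- A sum over a finite group only depends on the sums over the cosets of a subgroup. -/
theorem sum_eq_sum_of_coset_sum_eq {G H M : Type*} [Group G] [Fintype G] [Group H] [Fintype H]
    [AddCommMonoid M] (ι : H →* G) (hι : Function.Injective ι) (K K' : G → M)
    (h : ∀ g, ∑ x, K (g * ι x) = ∑ x, K' (g * ι x)) : ∑ g, K g = ∑ g, K' g := by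
  classical
  have key : ∀ K : G → M,
      ∑ g, K g = ∑ q : G ⧸ ι.range, ∑ x : H, K (q.out * ι x) := by
    intro K
    rw [← Fintype.sum_prod_type' (f := fun (q : G ⧸ ι.range) x => K (q.out * ι x))]
    refine (Fintype.sum_bijective (fun z : (G ⧸ ι.range) × H => z.1.out * ι z.2)
      ⟨?_, fun g => ?_⟩ _ _ fun _ => rfl).symm
    · rintro ⟨q, x⟩ ⟨q', x'⟩ h
      have hq : ∀ (q : G ⧸ ι.range) (x : H), ((q.out * ι x : G) : G ⧸ ι.range) = q := fun q x => by
        rw [QuotientGroup.mk_mul_of_mem _ (MonoidHom.mem_range.2 ⟨x, rfl⟩), QuotientGroup.out_eq']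
      have h' : q = q' := by rw [← hq q x, ← hq q' x']; exact congrArg _ h
      subst h'
      simpa [hι.eq_iff] using h
    · obtain ⟨y, hy⟩ : (g : G ⧸ ι.range).out⁻¹ * g ∈ ι.range :=
        QuotientGroup.eq.1 (QuotientGroup.out_eq' _)
      exact ⟨(g, y), by simp [hy]⟩
  rw [key, key]
  exact Finset.sum_congr rfl fun q _ => h _

section Gadget

variable {V P : Type*}

/-- The role of a vertex as a column for the gadget `p` whose outgoing links lead to `u p` (from
the vertex `c`) and `v p` (from the vertex `a`). -/
def portIndex [DecidableEq V] [DecidableEq P] (u v : P → V) (p : P) : V ⊕ P × Fin 4 → Fin 7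
  | .inl w => if w = u p then 4 else if w = v p then 5 else 6
  | .inr (q, j) => if q = p then ⟨j, by omega⟩ else 6

theorem portIndex_inj [DecidableEq V] [DecidableEq P] {u v : P → V} {p : P} {x y : V ⊕ P × Fin 4}
    (h : portIndex u v p x = portIndex u v p y) : x = y ∨ portIndex u v p x = 6 := by
  rcases x with w | ⟨q, i⟩ <;> rcases y with w' | ⟨q', j⟩ <;> simp only [portIndex] at h ⊢
  · split_ifs at h ⊢ <;> simp_all
  · split_ifs at h ⊢ <;> simp_all [Fin.ext_iff] <;> omega
  · split_ifs at h ⊢ <;> simp_all [Fin.ext_iff] <;> omega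
  · split_ifs at h ⊢ <;> simp_all [Fin.ext_iff]

/-- The permutations of the vertices of the gadget `p`. -/
noncomputable def gadgetPerm (V : Type*) {P : Type*} (p : P) :
    Equiv.Perm (Fin 4) →* Equiv.Perm (V ⊕ P × Fin 4) :=
  Equiv.Perm.viaEmbeddingHom ⟨fun i => .inr (p, i), fun i j h => by simpa using h⟩

theorem gadgetPerm_injective (p : P) : Function.Injective (gadgetPerm V p) :=
  Equiv.Perm.viaEmbeddingHom_injective _

theorem gadgetPerm_inr_self (p : P) (π : Equiv.Perm (Fin 4)) (i : Fin 4) :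
    gadgetPerm V p π (.inr (p, i)) = .inr (p, π i) :=
  Equiv.Perm.viaEmbedding_apply π
    ⟨fun i => (.inr (p, i) : V ⊕ P × Fin 4), fun i j h => by simpa using h⟩ i

theorem gadgetPerm_inl (p : P) (π : Equiv.Perm (Fin 4)) (w : V) :
    gadgetPerm V p π (.inl w) = .inl w :=
  Equiv.Perm.viaEmbedding_apply_of_notMem _ _ _ (by rintro ⟨i, h⟩; cases h)

theorem gadgetPerm_inr_of_ne {p q : P} (h : q ≠ p) (π : Equiv.Perm (Fin 4)) (i : Fin 4) :
    gadgetPerm V p π (.inr (q, i)) = .inr (q, i) :=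
  Equiv.Perm.viaEmbedding_apply_of_notMem _ _ _ (by rintro ⟨j, h'⟩; cases h'; exact h rfl)

theorem sign_gadgetPerm [Fintype V] [Fintype P] [DecidableEq V] [DecidableEq P] (p : P) (π : Equiv.Perm (Fin 4)) :
    Equiv.Perm.sign (gadgetPerm V p π) = Equiv.Perm.sign π := by
  exact @Equiv.Perm.sign_extendDomain _ _ _ _ _ _ π _ (fun _ => Classical.propDecidable _) _

end Gadget

/-- Weight of the choice of columns `t` in the rows of an XOR gadget. -/
def portWeight (F : Type*) [Field F] (t : Fin 4 → Fin 7) : M2 F :=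
  (Int.castRingHom F).mapMatrix (portProdInt t)

/-- Weight of the same choice after the gadget has been replaced by two single links. -/
def linkWeight (F : Type*) [Field F] (t : Fin 4 → Fin 7) : M2 F :=
  (Int.castRingHom F).mapMatrix (linkProdInt t)

theorem alternating_portWeight (F : Type*) [Field F] (t : Fin 4 → Fin 7) (h1 : ∃ i, t i = 1)
    (h3 : ∃ i, t i = 3) (hinj : ∀ i j, t i = t j → i = j ∨ t i = 6) :
    ∑ π : Equiv.Perm (Fin 4), Equiv.Perm.sign π • portWeight F (t ∘ π) =
      ∑ π : Equiv.Perm (Fin 4), Equiv.Perm.sign π • linkWeight F (t ∘ π) := by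
  have h := congrArg (Int.castRingHom F).mapMatrix (alternating_portProdInt t h1 h3 hinj)
  simp only [map_sum, Units.smul_def, map_zsmul] at h
  exact h

section Gadget

variable {V P F : Type*} [DecidableEq V] [DecidableEq P] [Field F]

/-- The columns chosen by `σ` in the rows of the gadget `p`. -/
def portChoice (u v : P → V) (σ : Equiv.Perm (V ⊕ P × Fin 4)) (p : P) : Fin 4 → Fin 7 :=
  fun i => portIndex u v p (σ (.inr (p, i)))

theorem portChoice_mul_self (u v : P → V) (σ : Equiv.Perm (V ⊕ P × Fin 4)) (p : P)
    (π : Equiv.Perm (Fin 4)) :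
    portChoice u v (σ * gadgetPerm V p π) p = portChoice u v σ p ∘ π := by
  funext i
  simp [portChoice, gadgetPerm_inr_self]

theorem portChoice_mul_of_ne (u v : P → V) (σ : Equiv.Perm (V ⊕ P × Fin 4)) {p q : P} (h : q ≠ p)
    (π : Equiv.Perm (Fin 4)) :
    portChoice u v (σ * gadgetPerm V p π) q = portChoice u v σ q := by
  funext i
  simp [portChoice, gadgetPerm_inr_of_ne h]

variable [Fintype V] [Fintype P]

/-- Replacing the weights of a single gadget by those of two single links. -/
theorem sum_replace_gadget (u v : P → V) (b : V → V ⊕ P × Fin 4 → F)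
    (hb1 : ∀ w p, b w (.inr (p, 1)) = 0) (hb3 : ∀ w p, b w (.inr (p, 3)) = 0)
    (w₁ w₂ : (Fin 4 → Fin 7) → M2 F) (hw₁ : ∀ t i, t i = 6 → w₁ t = 0)
    (hw₂ : ∀ t i, t i = 6 → w₂ t = 0) (l₁ l₂ : List P) (p : P) (hp₁ : p ∉ l₁) (hp₂ : p ∉ l₂)
    (hall : ∀ q, q ≠ p → q ∈ l₁ ∨ q ∈ l₂) :
    ∑ σ : Equiv.Perm (V ⊕ P × Fin 4), Equiv.Perm.sign σ • (∏ x, b x (σ (.inl x))) •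
      ((l₁.map fun q => w₁ (portChoice u v σ q)).prod * portWeight F (portChoice u v σ p) *
        (l₂.map fun q => w₂ (portChoice u v σ q)).prod) =
    ∑ σ : Equiv.Perm (V ⊕ P × Fin 4), Equiv.Perm.sign σ • (∏ x, b x (σ (.inl x))) •
      ((l₁.map fun q => w₁ (portChoice u v σ q)).prod * linkWeight F (portChoice u v σ p) *
        (l₂.map fun q => w₂ (portChoice u v σ q)).prod) := by
  -- Right multiplication by a permutation of the four gadget vertices only redistributes columns
  -- among their rows; the scalar factor and the factors of all other gadgets are constant on the
  -- coset.
  refine sum_eq_sum_of_coset_sum_eq (gadgetPerm V p) (gadgetPerm_injective p) _ _ fun σ => ?_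
  have hl : ∀ (w : (Fin 4 → Fin 7) → M2 F) (l : List P), p ∉ l → ∀ π,
      (l.map fun q => w (portChoice u v (σ * gadgetPerm V p π) q)) =
        l.map fun q => w (portChoice u v σ q) := by
    intro w l hpl π
    refine List.map_congr_left fun q hq => ?_
    rw [portChoice_mul_of_ne _ _ _ (by rintro rfl; exact hpl hq)]
  have pull : ∀ w : (Fin 4 → Fin 7) → M2 F,
      ∑ π : Equiv.Perm (Fin 4), Equiv.Perm.sign (σ * gadgetPerm V p π) •
        (∏ x, b x ((σ * gadgetPerm V p π) (.inl x))) •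
        ((l₁.map fun q => w₁ (portChoice u v (σ * gadgetPerm V p π) q)).prod *
          w (portChoice u v (σ * gadgetPerm V p π) p) *
          (l₂.map fun q => w₂ (portChoice u v (σ * gadgetPerm V p π) q)).prod) =
      Equiv.Perm.sign σ • (∏ x, b x (σ (.inl x))) •
        ((l₁.map fun q => w₁ (portChoice u v σ q)).prod *
          (∑ π : Equiv.Perm (Fin 4), Equiv.Perm.sign π • w (portChoice u v σ p ∘ π)) *
          (l₂.map fun q => w₂ (portChoice u v σ q)).prod) := by
    intro w
    simp only [hl _ _ hp₁, hl _ _ hp₂, portChoice_mul_self, Equiv.Perm.sign_mul, sign_gadgetPerm,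
      Equiv.Perm.mul_apply, gadgetPerm_inl, Finset.mul_sum, Finset.sum_mul, Finset.smul_sum]
    refine Finset.sum_congr rfl fun π _ => ?_
    simp only [mul_smul, Units.smul_def, mul_smul_comm, smul_mul_assoc]
    rw [smul_comm (∏ x, b x (σ (.inl x)))]
  rw [pull, pull]
  -- If the column of `b` or `d` is used by an outside row, the term vanishes: a base row has entry
  -- zero there, and for another gadget it is the zero column. `hall` guarantees that every other
  -- gadget occurs as a factor.
  have cover : ∀ j : Fin 4, (∀ w, b w (.inr (p, j)) = 0) →
      (∃ i, portChoice u v σ p i = ⟨j, by omega⟩) ∨ (∏ x, b x (σ (.inl x))) = 0 ∨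
      (l₁.map fun q => w₁ (portChoice u v σ q)).prod = 0 ∨
      (l₂.map fun q => w₂ (portChoice u v σ q)).prod = 0 := by
    intro j hbj
    obtain ⟨y, hy⟩ := σ.surjective (.inr (p, j))
    rcases y with x | ⟨q, i⟩
    · exact .inr (.inl (Finset.prod_eq_zero (Finset.mem_univ x) (by rw [hy, hbj])))
    · by_cases hq : q = p
      · subst hq
        exact .inl ⟨i, by simp [portChoice, hy, portIndex]⟩
      · have h6 : portChoice u v σ q i = 6 := by
          simp [portChoice, hy, portIndex, Ne.symm hq]
        rcases hall q hq with hq | hq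
        · exact .inr (.inr (.inl (List.prod_eq_zero
            (List.mem_map.2 ⟨q, hq, hw₁ _ i h6⟩))))
        · exact .inr (.inr (.inr (List.prod_eq_zero
            (List.mem_map.2 ⟨q, hq, hw₂ _ i h6⟩))))
  rcases cover 1 (fun w => hb1 w p) with h1 | h | h | h
  · rcases cover 3 (fun w => hb3 w p) with h3 | h | h | h
    · rw [alternating_portWeight F _ h1 h3]
      intro i j hij
      rcases portIndex_inj hij with h | h
      · left; simpa using h
      · exact .inr h
    all_goals simp [h]
  all_goals simp [h]

theorem portWeight_eq_zero {t : Fin 4 → Fin 7} {i : Fin 4} (h : t i = 6) : portWeight F t = 0 := by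
  rw [portWeight, portProdInt_eq_zero h, map_zero]

theorem linkWeight_eq_zero {t : Fin 4 → Fin 7} {i : Fin 4} (h : t i = 6) : linkWeight F t = 0 := by
  rw [linkWeight, linkProdInt_eq_zero h, map_zero]

/-- Replacing the weights of all gadgets by those of two single links. -/
theorem sum_replace_gadgets (u v : P → V) (b : V → V ⊕ P × Fin 4 → F)
    (hb1 : ∀ w p, b w (.inr (p, 1)) = 0) (hb3 : ∀ w p, b w (.inr (p, 3)) = 0)
    (l₁ l₂ : List P) (hl : (l₁ ++ l₂).Nodup) (hall : ∀ q, q ∈ l₁ ++ l₂) :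
    ∑ σ : Equiv.Perm (V ⊕ P × Fin 4), Equiv.Perm.sign σ • (∏ x, b x (σ (.inl x))) •
      ((l₁.map fun q => linkWeight F (portChoice u v σ q)).prod *
        (l₂.map fun q => portWeight F (portChoice u v σ q)).prod) =
    ∑ σ : Equiv.Perm (V ⊕ P × Fin 4), Equiv.Perm.sign σ • (∏ x, b x (σ (.inl x))) •
      ((l₁ ++ l₂).map fun q => linkWeight F (portChoice u v σ q)).prod := by
  induction l₂ generalizing l₁ with
  | nil => simp
  | cons p l₂ ih =>
    -- The factors keep their order: those to the left of `p` are already replaced, those to the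
    -- right not yet.
    have ih' := ih (l₁ ++ [p]) (by simpa using hl) (by simpa using hall)
    rw [List.append_assoc, List.singleton_append] at ih'
    rw [← ih']
    have := sum_replace_gadget (F := F) u v b hb1 hb3 (linkWeight F) (portWeight F)
      (fun _ _ => linkWeight_eq_zero) (fun _ _ => portWeight_eq_zero) l₁ l₂ p
      (by rintro h; simp [List.nodup_append] at hl; exact hl.2.2 p h |>.1 rfl)
      (by rintro h; simp [List.nodup_append, h] at hl)
      (fun q hq => by simpa [hq] using hall q)
    simpa [mul_assoc] using this

end Gadget

/-! ### The order of the rows in the Cayley determinant. -/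

theorem exists_list_pairwise_lt {α β : Type*} [Fintype α] [LinearOrder β] (f : α → β)
    (hf : Function.Injective f) : ∃ l : List α, l.Pairwise (fun a b => f a < f b) ∧ ∀ a, a ∈ l := by
  let _ := LinearOrder.lift' f hf
  refine ⟨(Finset.univ : Finset α).sort (· ≤ ·), ?_, by simp⟩
  exact (Finset.sortedLT_sort (Finset.univ : Finset α)).pairwise

/-- The vertices `a, b, c, d` of the gadget `p`. -/
def gadgetVertices (V : Type*) {P : Type*} (p : P) : List (V ⊕ P × Fin 4) :=
  [.inr (p, 0), .inr (p, 1), .inr (p, 2), .inr (p, 3)]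

/-- Both lists are strictly increasing under `e` and have the same members, so they coincide. -/
theorem exists_list_vertices {V P : Type*} [Fintype V] [Fintype P] {N : ℕ}
    (e : V ⊕ P × Fin 4 ≃ Fin N) (base_lt : ∀ v q, e (.inl v) < e (.inr q))
    (consecutive : ∀ p i, (e (.inr (p, i)) : ℕ) = e (.inr (p, 0)) + i) :
    ∃ (lV : List V) (lP : List P), lV.Nodup ∧ (∀ v, v ∈ lV) ∧ lP.Nodup ∧ (∀ p, p ∈ lP) ∧
      (List.finRange N).map e.symm = lV.map .inl ++ lP.flatMap (gadgetVertices V) := by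
  obtain ⟨lV, hV, hV'⟩ := exists_list_pairwise_lt (fun v => e (.inl v : V ⊕ P × Fin 4))
    (e.injective.comp Sum.inl_injective)
  obtain ⟨lP, hP, hP'⟩ := exists_list_pairwise_lt (fun p => e (.inr (p, 0) : V ⊕ P × Fin 4))
    (fun p q h => by simpa using h)
  refine ⟨lV, lP, hV.imp (fun {a b} h hab => h.ne (by rw [hab])), hV',
    hP.imp (fun {a b} h hab => h.ne (by rw [hab])), hP', ?_⟩
  have hlt : ∀ {p q : P}, e (.inr (p, 0)) < e (.inr (q, 0)) → ∀ i j,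
      e (.inr (p, i)) < e (.inr (q, j)) := by
    intro p q h i j
    -- The number of `(q, 0)` exceeds that of `(p, 0)` and differs from the three following it, so
    -- it lies beyond the whole block of `p`.
    have hne : ∀ k : Fin 4, e (.inr (p, k)) ≠ e (.inr (q, 0)) := fun k hk => by
      have : p = q := by simpa using congrArg Prod.fst (Sum.inr_injective (e.injective hk))
      subst this
      exact h.ne rfl
    have h0 := fun k => Fin.val_ne_of_ne (hne k)
    have e1 := consecutive p 1
    have e2 := consecutive p 2
    have e3 := consecutive p 3
    have f1 := h0 1
    have f2 := h0 2
    have f3 := h0 3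
    have ei := consecutive p i
    have ej := consecutive q j
    rw [Fin.lt_def] at h ⊢
    simp at e1 e2 e3
    omega
  have hpair : (lV.map Sum.inl ++ lP.flatMap (gadgetVertices V)).Pairwise fun x y => e x < e y := by
    rw [List.pairwise_append]
    refine ⟨List.pairwise_map.2 hV, ?_, ?_⟩
    · rw [List.pairwise_flatMap]
      refine ⟨fun p _ => ?_, hP.imp fun h x hx y hy => ?_⟩
      · have h1 : ∀ i j : Fin 4, i < j → e (.inr (p, i)) < e (.inr (p, j)) := by
          intro i j hij
          have := consecutive p i
          have := consecutive p j
          rw [Fin.lt_def] at *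
          omega
        simp [gadgetVertices, h1]
      · simp only [gadgetVertices, List.mem_cons, List.not_mem_nil, or_false] at hx hy
        rcases hx with rfl | rfl | rfl | rfl <;> rcases hy with rfl | rfl | rfl | rfl <;>
          exact hlt h _ _
    · intro x hx y hy
      obtain ⟨v, -, rfl⟩ := List.mem_map.1 hx
      obtain ⟨p, -, hy⟩ := List.mem_flatMap.1 hy
      simp only [gadgetVertices, List.mem_cons, List.not_mem_nil, or_false] at hy
      rcases hy with rfl | rfl | rfl | rfl <;> exact base_lt _ _
  have hfin : ((List.finRange N).map e.symm).Pairwise fun x y => e x < e y := by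
    simpa [List.pairwise_map] using List.pairwise_lt_finRange N
  refine List.Perm.eq_of_pairwise (fun a b _ _ h h' => (h.asymm h').elim) hfin hpair ?_
  rw [List.perm_ext_iff_of_nodup (hfin.imp fun {a b} h hab => h.ne (by rw [hab]))
    (hpair.imp fun {a b} h hab => h.ne (by rw [hab]))]
  intro x
  refine iff_of_true (List.mem_map.2 ⟨e x, by simp, by simp⟩) ?_
  rw [List.mem_append]
  rcases x with v | ⟨p, i⟩
  · exact .inl (List.mem_map.2 ⟨v, hV' v, rfl⟩)
  · refine .inr (List.mem_flatMap.2 ⟨p, hP' p, ?_⟩)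
    fin_cases i <;> simp [gadgetVertices]

/-- The Cayley determinant, when the rows of the base vertices are scalar and come first, and the
remaining rows come in consecutive groups of four. -/
theorem exists_cayleyDet_reindex_eq {V P R A : Type*} [Fintype V] [Fintype P] [DecidableEq V]
    [DecidableEq P] [CommRing R] [Ring A] [Algebra R A] {N : ℕ}
    (e : V ⊕ P × Fin 4 ≃ Fin N) (base_lt : ∀ v q, e (.inl v) < e (.inr q))
    (consecutive : ∀ p i, (e (.inr (p, i)) : ℕ) = e (.inr (p, 0)) + i)
    (M : Matrix (V ⊕ P × Fin 4) (V ⊕ P × Fin 4) A) (b : V → V ⊕ P × Fin 4 → R)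
    (hM : ∀ v x, M (.inl v) x = algebraMap R A (b v x)) :
    ∃ l : List P, l.Nodup ∧ (∀ p, p ∈ l) ∧ cayleyDet (Matrix.reindex e e M) =
      ∑ σ : Equiv.Perm (V ⊕ P × Fin 4), Equiv.Perm.sign σ • (∏ v, b v (σ (.inl v))) •
        (l.map fun p => ((gadgetVertices V p).map fun x => M x (σ x)).prod).prod := by
  obtain ⟨lV, lP, hV, hV', hP, hP', h⟩ := exists_list_vertices e base_lt consecutive
  refine ⟨lP, hP, hP', ?_⟩
  rw [cayleyDet, ← Equiv.sum_comp e.permCongr]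
  refine Finset.sum_congr rfl fun σ _ => ?_
  rw [Equiv.Perm.sign_permCongr]
  congr 1
  have h1 : (List.ofFn fun i => Matrix.reindex e e M i (e.permCongr σ i)) =
      ((List.finRange N).map e.symm).map fun x => M x (σ x) := by
    rw [List.ofFn_eq_map, List.map_map]
    exact List.map_congr_left fun i _ => by simp
  rw [h1, h, List.map_append, List.prod_append, Algebra.smul_def]
  congr 1
  · rw [List.map_map]
    have h2 : ((fun x => M x (σ x)) ∘ Sum.inl) = fun v => algebraMap R A (b v (σ (.inl v))) := by
      funext v; simp [hM]
    have h3 : lV.toFinset = Finset.univ := by ext v; simp [hV']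
    rw [h2, ← h3, List.prod_toFinset _ hV, map_list_prod, List.map_map]
    rfl
  · rw [List.map_flatMap, List.flatMap, List.prod_flatten, List.map_map]
    rfl

/-! ### Eliminating an index from a determinant. -/

namespace Matrix

variable {N R : Type*} [Fintype N] [DecidableEq N] [CommRing R]

/-- If some rows are unit rows at their own diagonal entry, the entries of the other rows in the
corresponding columns do not influence the determinant. -/
theorem det_congr_of_unit_rows (X : N → Prop) (M M' : Matrix N N R)
    (h : ∀ i, X i → M i = Pi.single i 1) (h' : ∀ i, X i → M' i = Pi.single i 1)
    (heq : ∀ i j, ¬ X i → ¬ X j → M i j = M' i j) : M.det = M'.det := by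
  rw [← det_transpose M, ← det_transpose M', det_apply', det_apply']
  refine Finset.sum_congr rfl fun σ _ => ?_
  congr 1
  simp only [transpose_apply]
  -- A permutation contributes only if it fixes the indices of all unit rows; their columns are then
  -- taken, and the other rows never meet them.
  by_cases hX : ∀ i, X i → σ i = i
  · refine Finset.prod_congr rfl fun i _ => ?_
    by_cases hi : X i
    · rw [h i hi, h' i hi]
    · refine heq i _ hi fun hσ => hi ?_
      have := σ.injective (hX _ hσ)
      rwa [this] at hσ
  · push Not at hX
    obtain ⟨i, hi, hσ⟩ := hX
    rw [Finset.prod_eq_zero (Finset.mem_univ i), Finset.prod_eq_zero (Finset.mem_univ i)]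
    · rw [h' i hi, Pi.single_eq_of_ne hσ]
    · rw [h i hi, Pi.single_eq_of_ne hσ]

/-- Laplace expansion along column `x`. A unit row takes the place of the minor, so that the index
set does not change. -/
theorem det_eq_mul_det_updateRow_single (M : Matrix N N R) (x : N) (h : ∀ i, i ≠ x → M i x = 0) :
    M.det = M x x * (M.updateRow x (Pi.single x 1)).det := by
  rw [det_apply', det_apply', Finset.mul_sum]
  refine Finset.sum_congr rfl fun σ _ => ?_
  rw [mul_left_comm]
  congr 1
  by_cases hσ : σ x = x
  · rw [← Finset.mul_prod_erase _ _ (Finset.mem_univ x),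
      ← Finset.mul_prod_erase Finset.univ _ (Finset.mem_univ x), hσ]
    simp only [updateRow_self, Pi.single_eq_same, one_mul]
    congr 1
    refine Finset.prod_congr rfl fun i hi => ?_
    rw [updateRow_ne]
    intro h'
    exact Finset.ne_of_mem_erase hi (σ.injective (h'.trans hσ.symm))
  · obtain ⟨y, hy⟩ := σ.surjective x
    have hyx : y ≠ x := by rintro rfl; exact hσ hy
    rw [Finset.prod_eq_zero (f := fun i => M (σ i) i) (Finset.mem_univ x) (h _ hσ),
      Finset.prod_eq_zero (Finset.mem_univ y), mul_zero]
    rw [hy, updateRow_self, Pi.single_eq_of_ne hyx]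

/-- If a column `x` is supported on a single row `z ≠ x`, then the index `x` can be eliminated: the
row `z` becomes the row `x`, and the row `x` a unit row. -/
theorem det_eq_neg_of_col_supported (M : Matrix N N R) {x z : N} (hxz : x ≠ z)
    (h : ∀ i, i ≠ z → M i x = 0) :
    M.det = -(M z x * ((M.updateRow z (M x)).updateRow x (Pi.single x 1)).det) := by
  -- Exchanging the two rows brings the only possible nonzero entry of column `x` to the diagonal.
  have h1 : (M.submatrix (Equiv.swap x z) id).det = -M.det := by
    rw [det_permute, Equiv.Perm.sign_swap hxz]; simp
  have h2 := det_eq_mul_det_updateRow_single (M.submatrix (Equiv.swap x z) id) x fun i hi => by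
    refine h _ fun h' => hi ?_
    exact (Equiv.swap x z).injective (h'.trans (Equiv.swap_apply_left x z).symm)
  rw [← neg_eq_iff_eq_neg, ← h1, h2]
  simp only [submatrix_apply, Equiv.swap_apply_left, id]
  congr 2
  ext i j
  by_cases hi : i = x
  · subst hi; simp
  · rw [updateRow_ne hi, updateRow_ne hi]
    by_cases hz : i = z
    · subst hz; simp
    · rw [updateRow_ne hz, submatrix_apply, Equiv.swap_apply_of_ne_of_ne hi hz, id]

end Matrix

/-! ### From subdivided edges to forced edges. -/

section Links

variable {V E P R : Type*} [Fintype V] [Fintype E] [Fintype P] [DecidableEq V] [DecidableEq E]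
  [DecidableEq P] [CommRing R]

/-- The weight of the edge `e`, when for `p ∈ S` the edge `s p` must be used, for `p ∉ S` it
must not be used, and the edges `r p` must not be used. -/
def forcedWeight (src : E → V) (w : E → R) (s r : P → E) (S : Finset P) (e : E) : R :=
  if (∀ p ∈ S, src (s p) = src e → s p = e) ∧ (∀ p, p ∉ S → s p ≠ e) ∧ ∀ p, r p ≠ e then w e else 0

/-- The adjacency matrix of a graph in which the edges `s p` for `p ∉ S` are led through a new
vertex `(p, ι p)` without a self-loop, and the edges `s p` for `p ∈ S` must be used; the remaining
new vertices carry self-loops only. -/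
def linkMatrix (src tgt : E → V) (w : E → R) (s r : P → E) (ι : P → Fin 4) (S : Finset P) :
    Matrix (V ⊕ P × Fin 4) (V ⊕ P × Fin 4) R
  | .inl v, .inl v' => ∑ e, if src e = v ∧ tgt e = v' then forcedWeight src w s r S e else 0
  | .inl v, .inr (p, j) =>
      if j = ι p ∧ p ∉ S ∧ src (s p) = v ∧ ∀ q ∈ S, src (s q) ≠ v then 1 else 0
  | .inr (p, j), y => if j = ι p ∧ p ∉ S then (Pi.single (.inl (tgt (s p))) 1 : _ → R) y
      else (Pi.single (.inr (p, j)) 1 : _ → R) y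

variable (src tgt : E → V) (w : E → R) (s r : P → E) (ι : P → Fin 4)

/-- The new vertex of `p` can be entered only from the source of `s p`, so it can be eliminated. The
row of the source then becomes the unit row at the target, as it does when the edge is forced.
Shortening the cycle through it by one vertex gives the sign. -/
theorem det_linkMatrix_insert (hs : Function.Injective s) (hsr : ∀ p q, s p ≠ r q)
    (hw : ∀ p, w (s p) = 1) (S : Finset P) (p : P) (hp : p ∉ S) :
    (linkMatrix src tgt w s r ι S).det = -(linkMatrix src tgt w s r ι (insert p S)).det := by
  -- If an edge with the same source is already forced, both determinants vanish: the new vertex can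
  -- no longer be entered, and two edges forced at one source leave no edge there.
  by_cases hc : ∃ q ∈ S, src (s q) = src (s p)
  · obtain ⟨q, hq, hqp⟩ := hc
    have hne : q ≠ p := by rintro rfl; exact hp hq
    rw [Matrix.det_eq_zero_of_column_eq_zero (.inr (p, ι p)),
      Matrix.det_eq_zero_of_row_eq_zero (.inl (src (s p))), neg_zero]
    · rintro (v | ⟨q', j⟩)
      · refine Finset.sum_eq_zero fun e _ => ?_
        rw [ite_eq_right_iff]
        rintro ⟨h, -⟩
        refine if_neg fun h' => hne (hs ?_)
        rw [h'.1 q (by simp [hq]) (hqp.trans h.symm), h'.1 p (by simp) h.symm]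
      · exact if_neg fun h => h.2.2.2 q (by simp [hq]) hqp
    · rintro (v | ⟨q', j⟩)
      · exact if_neg fun h => h.2.2.2 q hq (by rw [hqp, h.2.2.1])
      · simp only [linkMatrix]
        split_ifs with h
        · simp
        · rw [Pi.single_eq_of_ne]
          rintro h'
          simp only [Sum.inr.injEq, Prod.mk.injEq] at h'
          obtain ⟨rfl, rfl⟩ := h'
          exact h ⟨rfl, hp⟩
  · push Not at hc
    rw [Matrix.det_eq_neg_of_col_supported _ (x := .inr (p, ι p)) (z := .inl (src (s p)))
      Sum.inr_ne_inl]
    · have h1 : linkMatrix src tgt w s r ι S (.inl (src (s p))) (.inr (p, ι p)) = 1 :=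
        if_pos ⟨rfl, hp, rfl, hc⟩
      rw [h1, one_mul]
      congr 2
      ext i y
      by_cases hi : i = .inr (p, ι p)
      · subst hi
        simp [linkMatrix]
      rw [Matrix.updateRow_ne hi]
      by_cases hz : i = .inl (src (s p))
      · subst hz
        rw [Matrix.updateRow_self]
        rcases y with v | ⟨q, j⟩
        · have h2 : ∀ e, (if src e = src (s p) ∧ tgt e = v then
              forcedWeight src w s r (insert p S) e else 0) =
              if e = s p then (if tgt (s p) = v then 1 else 0 : R) else 0 := by
            intro e
            by_cases he : e = s p
            · subst he
              have : forcedWeight src w s r (insert p S) (s p) = 1 := by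
                rw [forcedWeight, if_pos, hw]
                refine ⟨?_, fun q hq h => hq (by simp [hs h]), fun q => (hsr p q).symm⟩
                intro q hq h
                rcases Finset.mem_insert.1 hq with rfl | hq
                · rfl
                · exact absurd h (hc q hq)
              simp [this]
            · rw [if_neg he, ite_eq_right_iff]
              rintro ⟨h, -⟩
              exact if_neg fun h' => he (h'.1 p (by simp) h.symm).symm
          simp only [linkMatrix, h2]
          simp [hp, Pi.single_apply, eq_comm]
        · simp [linkMatrix, hp]
      rw [Matrix.updateRow_ne hz]
      rcases i with v | ⟨q, j⟩
      · have hv : src (s p) ≠ v := fun h => hz (by rw [h])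
        rcases y with v' | ⟨q, j⟩
        · refine Finset.sum_congr rfl fun e _ => ?_
          by_cases he : src e = v ∧ tgt e = v'
          · rw [if_pos he, if_pos he, forcedWeight, forcedWeight]
            have he' : src (s p) ≠ src e := by rw [he.1]; exact hv
            have he'' : s p ≠ e := fun h => he' (by rw [h])
            refine if_congr ?_ rfl rfl
            refine and_congr ?_ (and_congr ?_ Iff.rfl)
            · simp [he']
            · refine forall_congr' fun q => ?_
              by_cases hq : q = p
              · subst hq; simp [hp, he'']
              · simp [hq]
          · rw [if_neg he, if_neg he]
        · refine if_congr ?_ rfl rfl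
          by_cases hq : q = p
          · subst hq; simp [hv]
          · simp [hq, hv]
      · simp only [linkMatrix]
        refine if_congr ?_ rfl rfl
        refine and_congr_right fun h => ?_
        have hq : q ≠ p := by rintro rfl; exact hi (by rw [h])
        simp [hq]
    · rintro (v | ⟨q, j⟩) hz
      · exact if_neg fun h => hz (by rw [h.2.2.1])
      · simp only [linkMatrix]
        split_ifs with h
        · simp
        · rw [Pi.single_eq_of_ne]
          rintro h'
          simp only [Sum.inr.injEq, Prod.mk.injEq] at h'
          obtain ⟨rfl, rfl⟩ := h'
          exact h ⟨rfl, hp⟩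

theorem det_linkMatrix_empty (hs : Function.Injective s) (hsr : ∀ p q, s p ≠ r q)
    (hw : ∀ p, w (s p) = 1) (S : Finset P) :
    (linkMatrix src tgt w s r ι ∅).det = (-1) ^ S.card * (linkMatrix src tgt w s r ι S).det := by
  induction S using Finset.induction_on with
  | empty => simp
  | insert p S hp ih =>
    rw [ih, det_linkMatrix_insert src tgt w s r ι hs hsr hw S p hp, Finset.card_insert_of_notMem hp]
    ring

/-- Leading edges through new vertices amounts to forcing their use, up to the sign. -/
theorem det_linkMatrix (hs : Function.Injective s) (hsr : ∀ p q, s p ≠ r q)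
    (hw : ∀ p, w (s p) = 1) :
    (linkMatrix src tgt w s r ι ∅).det = (-1) ^ Fintype.card P *
      (Matrix.of fun v v' => ∑ e, if src e = v ∧ tgt e = v' then
        forcedWeight src w s r Finset.univ e else 0).det := by
  rw [det_linkMatrix_empty src tgt w s r ι hs hsr hw Finset.univ, Finset.card_univ]
  congr 1
  have : linkMatrix src tgt w s r ι Finset.univ = Matrix.fromBlocks
      (Matrix.of fun v v' => ∑ e, if src e = v ∧ tgt e = v' then
        forcedWeight src w s r Finset.univ e else 0) 0 0 1 := by
    ext (v | ⟨p, j⟩) (v' | ⟨q, k⟩)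
    · rfl
    · simp [linkMatrix]
    · simp [linkMatrix]
    · simp [linkMatrix, Matrix.one_apply, Pi.single_apply, eq_comm]
  rw [this, Matrix.det_fromBlocks_zero₂₁, Matrix.det_one, mul_one]

end Links

/-! ### The algebra spanned by `I` and `J`, and its character `J ↦ 1`. -/

/-- The matrix `D` is of the form `a • 1 + b • J` with `a + b = c`. -/
def IsJSum {F : Type*} [Field F] (D : M2 F) (c : F) : Prop :=
  ∃ a b : F, D = a • (1 : M2 F) + b • matJ F ∧ a + b = c

namespace IsJSum

variable {F : Type*} [Field F] {D D' : M2 F} {c c' : F}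

theorem zero : IsJSum (0 : M2 F) 0 := ⟨0, 0, by simp, by simp⟩

theorem one : IsJSum (1 : M2 F) 1 := ⟨1, 0, by simp, by simp⟩

theorem add (h : IsJSum D c) (h' : IsJSum D' c') : IsJSum (D + D') (c + c') := by
  obtain ⟨a, b, rfl, rfl⟩ := h
  obtain ⟨a', b', rfl, rfl⟩ := h'
  exact ⟨a + a', b + b', by module, by ring⟩

theorem smul (h : IsJSum D c) (r : F) : IsJSum (r • D) (r * c) := by
  obtain ⟨a, b, rfl, rfl⟩ := h
  exact ⟨r * a, r * b, by module, by ring⟩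

theorem mul (h : IsJSum D c) (h' : IsJSum D' c') : IsJSum (D * D') (c * c') := by
  obtain ⟨a, b, rfl, rfl⟩ := h
  obtain ⟨a', b', rfl, rfl⟩ := h'
  have hJ : matJ F * matJ F = 1 := by
    ext i j; fin_cases i <;> fin_cases j <;> simp [matJ]
  refine ⟨a * a' + b * b', a * b' + b * a', ?_, by ring⟩
  simp only [add_mul, mul_add, smul_mul_smul_comm, hJ, mul_one, one_mul]
  module

theorem units_smul (h : IsJSum D c) (z : ℤˣ) : IsJSum (z • D) (z • c) := by
  rcases Int.units_eq_one_or z with rfl | rfl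
  · simpa using h
  · simpa using h.smul (-1)

theorem sum {ι : Type*} (s : Finset ι) {D : ι → M2 F} {c : ι → F} (h : ∀ i, IsJSum (D i) (c i)) :
    IsJSum (∑ i ∈ s, D i) (∑ i ∈ s, c i) := by
  classical
  induction s using Finset.induction_on with
  | empty => simpa using zero
  | insert i s hi ih => rw [Finset.sum_insert hi, Finset.sum_insert hi]; exact (h i).add ih

theorem list_prod {ι : Type*} (l : List ι) {D : ι → M2 F} {c : ι → F}
    (h : ∀ i, IsJSum (D i) (c i)) : IsJSum (l.map D).prod (l.map c).prod := by
  induction l with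
  | nil => simpa using one
  | cons i l ih => simpa using (h i).mul ih

end IsJSum

/-! ### Graphs with XOR gadgets. -/

section Xor

variable {V E P F : Type*} [DecidableEq V] [DecidableEq P] [Field F]

/-- The row of the vertex `j` of the gadget `p` after the gadget has been replaced by a single
link: to `u p` from the vertex `a` if `c` holds, and to `v p` from the vertex `c` otherwise. -/
def linkRow (F : Type*) [Field F] (u v : P → V) (c : Bool) (p : P) (j : Fin 4)
    (y : V ⊕ P × Fin 4) : F :=
  if j = (if c then 0 else 2) then (Pi.single (.inl (if c then u p else v p)) 1 : _ → F) y
    else (Pi.single (.inr (p, j)) 1 : _ → F) y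

/-- The two links weigh `-4I` and `-4J`, and both have value `-4` under `J ↦ 1`. The hypothesis
`huv` is needed because `portIndex` would otherwise never report the second target. -/
theorem isJSum_linkWeight (u v : P → V) (huv : ∀ p, u p ≠ v p)
    (σ : Equiv.Perm (V ⊕ P × Fin 4)) (p : P) :
    IsJSum (linkWeight F (portChoice u v σ p))
      (-4 * ∑ c : Bool, ∏ j, linkRow F u v c p j (σ (.inr (p, j)))) := by
  have h4 : ∀ y : V ⊕ P × Fin 4, portIndex u v p y = 4 ↔ y = .inl (u p) := by
    rintro (w | ⟨q, j⟩) <;> simp only [portIndex]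
    · split_ifs <;> simp_all
    · split_ifs
      · fin_cases j <;> simp
      · simp
  have h5 : ∀ y : V ⊕ P × Fin 4, portIndex u v p y = 5 ↔ y = .inl (v p) := by
    rintro (w | ⟨q, j⟩) <;> simp only [portIndex]
    · split_ifs <;> simp_all
    · split_ifs
      · fin_cases j <;> simp
      · simp
  have hlt : ∀ (k : Fin 4) (y : V ⊕ P × Fin 4),
      portIndex u v p y = ⟨k, by omega⟩ ↔ y = .inr (p, k) := by
    rintro k (w | ⟨q, j⟩) <;> simp only [portIndex]
    · split_ifs <;> fin_cases k <;> simp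
    · split_ifs with h
      · simp [h, Fin.ext_iff]
      · fin_cases k <;> simp [h]
  have h0 : ∀ y, portIndex u v p y = 0 ↔ y = .inr (p, 0) := hlt 0
  have h1 : ∀ y, portIndex u v p y = 1 ↔ y = .inr (p, 1) := hlt 1
  have h2 : ∀ y, portIndex u v p y = 2 ↔ y = .inr (p, 2) := hlt 2
  have h3 : ∀ y, portIndex u v p y = 3 ↔ y = .inr (p, 3) := hlt 3
  rw [Fintype.sum_bool, mul_add, linkWeight, linkProdInt, map_add]
  refine IsJSum.add ?_ ?_
  · have : (∏ j, linkRow F u v true p j (σ (.inr (p, j)))) =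
        if portChoice u v σ p 0 = 4 ∧ portChoice u v σ p 1 = 1 ∧ portChoice u v σ p 2 = 2 ∧
          portChoice u v σ p 3 = 3 then 1 else 0 := by
      simp only [portChoice, h4, h1, h2, h3]
      simp [linkRow, Fin.prod_univ_four, Pi.single_apply, ← ite_and]
      exact if_congr (by tauto) rfl rfl
    rw [this]
    split_ifs
    · refine ⟨-4, 0, ?_, by simp⟩
      ext i j; fin_cases i <;> fin_cases j <;> simp
    · simpa using IsJSum.zero
  · have : (∏ j, linkRow F u v false p j (σ (.inr (p, j)))) =
        if portChoice u v σ p 0 = 0 ∧ portChoice u v σ p 1 = 1 ∧ portChoice u v σ p 2 = 5 ∧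
          portChoice u v σ p 3 = 3 then 1 else 0 := by
      simp only [portChoice, h0, h1, h5, h3]
      simp [linkRow, Fin.prod_univ_four, Pi.single_apply, ← ite_and]
      exact if_congr (by tauto) rfl rfl
    rw [this]
    split_ifs
    · refine ⟨0, -4, ?_, by simp⟩
      ext i j; fin_cases i <;> fin_cases j <;> simp [matJ]
    · simpa using IsJSum.zero

variable [Fintype E] [Fintype P] [DecidableEq E]

variable (G : WGraph V E (M2 F)) (f g : P → E) (w : E → F)

/-- The rows of the base vertices in a graph with XOR gadgets. -/
def baseRow (v : V) : V ⊕ P × Fin 4 → F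
  | .inl v' => ∑ e : E, if G.src e = v ∧ G.tgt e = v' then
      (if ∀ p, f p ≠ e ∧ g p ≠ e then w e else 0) else 0
  | .inr (p, j) => (if j = 0 ∧ G.src (f p) = v then 1 else 0) +
      (if j = 2 ∧ G.src (g p) = v then 1 else 0)

theorem XorLink.sum_univ {M : Type*} [AddCommMonoid M] (h : XorLink → M) :
    ∑ x, h x = h .uToA + (h .cToU + (h .vToC + h .aToV)) := by
  have : (Finset.univ : Finset XorLink) = {.uToA, .cToU, .vToC, .aToV} := rfl
  simp [this]

theorem adjacency_xorReplace_inl (hw : ∀ e, G.weight e = algebraMap F (M2 F) (w e)) (v : V)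
    (y : V ⊕ P × Fin 4) :
    (G.xorReplace f g).adjacency (.inl v) y = algebraMap F (M2 F) (baseRow G f g w v y) := by
  simp only [WGraph.adjacency, Matrix.of_apply, Fintype.sum_sum_type, Fintype.sum_prod_type,
    XorLink.sum_univ]
  rcases y with v' | ⟨p, j⟩
  · simp only [WGraph.xorReplace, baseRow, Sum.inl.injEq, reduceCtorEq, false_and, and_false,
      if_false, add_zero, Finset.sum_const_zero, map_sum]
    rw [← Finset.sum_subtype (Finset.univ.filter fun e => ∀ p, f p ≠ e ∧ g p ≠ e) (by simp)
      (fun e => if G.src e = v ∧ G.tgt e = v' then G.weight e else 0), Finset.sum_filter]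
    refine Finset.sum_congr rfl fun e _ => ?_
    split_ifs <;> simp [hw]
  · simp only [WGraph.xorReplace, baseRow, Sum.inl.injEq, reduceCtorEq, false_and, and_false,
      if_false, add_zero, zero_add, Finset.sum_const_zero, map_add, Sum.inr.injEq, Prod.mk.injEq]
    rw [Finset.sum_eq_single p, ]
    · congr 1 <;> split_ifs <;> simp_all
    · intro q _ hq
      simp [hq]
    · simp

theorem map_portColumnInt (F : Type*) [Field F] (i j : Fin 4) : (Int.castRingHom F).mapMatrix
    (portColumnInt ⟨j, by omega⟩ i) = xorWeight F i j := by
  have h2 : 2 * matY F = !![0, -2; -2, 0] := by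
    have : (2 : M2 F) = (2 : F) • 1 := by
      rw [← Nat.cast_ofNat (R := M2 F), ← Nat.cast_ofNat (R := F), Nat.cast_smul_eq_nsmul,
        nsmul_one]
    rw [this, smul_mul_assoc, one_mul, matY]
    simp
  have h3 : 3 * matX F = !![3, 0; 0, -3] := by
    have : (3 : M2 F) = (3 : F) • 1 := by
      rw [← Nat.cast_ofNat (R := M2 F), ← Nat.cast_ofNat (R := F), Nat.cast_smul_eq_nsmul,
        nsmul_one]
    rw [this, smul_mul_assoc, one_mul, matX]
    simp
  have hm : ∀ a b c d : ℤ, (!![a, b; c, d].map fun x => (x : F)) = !![(a : F), b; c, d] := by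
    intro a b c d
    ext i j
    fin_cases i <;> fin_cases j <;> rfl
  rw [xorWeight, h2, h3]
  fin_cases i <;> fin_cases j <;> simp [portColumnInt, matX, matY, matZ, hm]

theorem adjacency_xorReplace_inr (huv : ∀ p, G.tgt (f p) ≠ G.tgt (g p)) (p : P) (i : Fin 4)
    (y : V ⊕ P × Fin 4) :
    (G.xorReplace f g).adjacency (.inr (p, i)) y = (Int.castRingHom F).mapMatrix
      (portColumnInt (portIndex (G.tgt ∘ f) (G.tgt ∘ g) p y) i) := by
  simp only [WGraph.adjacency, Matrix.of_apply, Fintype.sum_sum_type, Fintype.sum_prod_type,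
    XorLink.sum_univ]
  rcases y with v | ⟨q, j⟩
  · simp only [WGraph.xorReplace, Sum.inl.injEq, reduceCtorEq, false_and, and_false,
      if_false, add_zero, zero_add, Finset.sum_const_zero, Sum.inr.injEq, Prod.mk.injEq]
    rw [Finset.sum_eq_single p]
    · have hne := huv p
      by_cases hA : v = G.tgt (f p)
      · subst hA
        fin_cases i <;> simp [portIndex, portColumnInt, hne.symm]
      · by_cases hB : v = G.tgt (g p)
        · subst hB
          fin_cases i <;> simp [portIndex, portColumnInt, hne, hA]
        · fin_cases i <;> simp [portIndex, portColumnInt, hA, hB, Ne.symm hA, Ne.symm hB]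
    · intro q _ hq
      simp [hq]
    · simp
  · simp only [WGraph.xorReplace, Sum.inr.injEq, reduceCtorEq, false_and, and_false,
      if_false, add_zero, zero_add, Finset.sum_const_zero, Prod.mk.injEq]
    by_cases hq : q = p
    · subst hq
      rw [Finset.sum_eq_single q (fun x _ hx => by simp [hx]) (by simp),
        Finset.sum_eq_single i (fun x _ hx => by simp [hx]) (by simp),
        Finset.sum_eq_single j (fun x _ hx => by simp [hx]) (by simp)]
      simp only [portIndex, and_self, if_true]
      exact (map_portColumnInt F i j).symm
    · rw [Finset.sum_eq_zero]
      · have h6 : portColumnInt 6 = 0 := rfl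
        simp [portIndex, hq, h6]
      · intro x _
        refine Finset.sum_eq_zero fun k _ => Finset.sum_eq_zero fun l _ => if_neg ?_
        rintro ⟨⟨rfl, -⟩, h, -⟩
        exact hq h.symm

end Xor

section Xor

variable {V E P F : Type*} [Fintype V] [Fintype E] [Fintype P] [DecidableEq V] [DecidableEq E]
  [DecidableEq P] [Field F]

/-- The sum over the cycle covers of a graph that use exactly the edge `f p` or exactly the edge
`g p` for each `p`, according to `T p`, is the determinant of this matrix. -/
def coverMatrix (src tgt : E → V) (w : E → F) (f g : P → E) (T : P → Bool) : Matrix V V F :=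
  Matrix.of fun v v' => ∑ e, if src e = v ∧ tgt e = v' then
    forcedWeight src w (fun p => if T p then f p else g p) (fun p => if T p then g p else f p)
      Finset.univ e else 0

/-- For a fixed choice `T` all gadget rows are unit rows, and the sum is an ordinary determinant.
Base entries leading to vertices with mere self-loops may be dropped, which leaves the graph with
the chosen edges subdivided; each subdivision contributes a factor `-1`. -/
theorem det_linkRow (G : WGraph V E (M2 F)) (f g : P → E) (w : E → F)
    (hf : Function.Injective f) (hg : Function.Injective g) (hfg : ∀ p q, f p ≠ g q)
    (hwf : ∀ p, w (f p) = 1) (hwg : ∀ p, w (g p) = 1) (T : P → Bool) :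
    ∑ σ : Equiv.Perm (V ⊕ P × Fin 4), Equiv.Perm.sign σ •
      ((∏ v, baseRow G f g w v (σ (.inl v))) *
        ∏ p, ∏ j, linkRow F (G.tgt ∘ f) (G.tgt ∘ g) (T p) p j (σ (.inr (p, j)))) =
    (-1) ^ Fintype.card P * (coverMatrix G.src G.tgt w f g T).det := by
  set s : P → E := fun p => if T p then f p else g p with hs_def
  set r : P → E := fun p => if T p then g p else f p with hr_def
  have hs : Function.Injective s := by
    intro p q h
    simp only [hs_def] at h
    split_ifs at h
    · exact hf h
    · exact absurd h (hfg _ _)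
    · exact absurd h.symm (hfg _ _)
    · exact hg h
  have hsr : ∀ p q, s p ≠ r q := by
    intro p q h
    simp only [hs_def, hr_def] at h
    split_ifs at h with h1 h2 h2
    · exact hfg _ _ h
    · rw [hf h] at h1; exact h2 h1
    · rw [hg h] at h1; exact h1 h2
    · exact hfg _ _ h.symm
  have hw : ∀ p, w (s p) = 1 := by
    intro p
    simp only [hs_def]
    split_ifs
    · exact hwf p
    · exact hwg p
  -- The path from `u` to `u'` passes through `a`, the one from `v` to `v'` through `c`.
  let ι : P → Fin 4 := fun p => if T p then 0 else 2
  rw [coverMatrix, ← det_linkMatrix G.src G.tgt w s r ι hs hsr hw]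
  let M : Matrix (V ⊕ P × Fin 4) (V ⊕ P × Fin 4) F := fun x y => match x with
    | .inl v => baseRow G f g w v y
    | .inr (p, j) => linkRow F (G.tgt ∘ f) (G.tgt ∘ g) (T p) p j y
  have hM : M.det = (linkMatrix G.src G.tgt w s r ι ∅).det := by
    refine Matrix.det_congr_of_unit_rows
      (fun x => ∃ p j, x = .inr (p, j) ∧ j ≠ ι p) _ _ ?_ ?_ ?_
    · rintro _ ⟨p, j, rfl, hj⟩
      funext y
      exact if_neg hj
    · rintro _ ⟨p, j, rfl, hj⟩
      funext y
      exact if_neg fun h => hj h.1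
    · rintro (v | ⟨p, i⟩) y hx hy
      · rcases y with v' | ⟨q, j⟩
        · refine Finset.sum_congr rfl fun e _ => if_congr Iff.rfl (if_congr ?_ rfl rfl) rfl
          simp only [Finset.notMem_empty, false_imp_iff, implies_true, true_and,
            not_false_eq_true, forall_const, ← forall_and, hs_def, hr_def]
          refine forall_congr' fun p => ?_
          split_ifs
          · rfl
          · exact and_comm
        · have hj : j = ι q := by
            by_contra h
            exact hy ⟨q, j, rfl, h⟩
          subst hj
          simp only [M, baseRow, linkMatrix, ι, s]
          split_ifs <;> simp_all
      · have hi : i = ι p := by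
          by_contra h
          exact hx ⟨p, i, rfl, h⟩
        simp only [M, linkMatrix, linkRow, Finset.notMem_empty, not_false_eq_true, and_true]
        rw [if_pos hi, if_pos hi]
        simp only [s]
        split_ifs <;> rfl
  rw [← hM, ← Matrix.det_transpose, Matrix.det_apply]
  refine Finset.sum_congr rfl fun σ _ => ?_
  rw [Fintype.prod_sum_type, Fintype.prod_prod_type]
  rfl

/-- The Cayley determinant of a graph with XOR gadgets. -/
theorem isJSum_cayleyDet_xorReplace (G : WGraph V E (M2 F)) (f g : P → E) (w : E → F)
    (hG : ∀ e, G.weight e = algebraMap F (M2 F) (w e))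
    (hf : Function.Injective f) (hg : Function.Injective g) (hfg : ∀ p q, f p ≠ g q)
    (htgt : ∀ p, G.tgt (f p) ≠ G.tgt (g p))
    (hwf : ∀ p, w (f p) = 1) (hwg : ∀ p, w (g p) = 1) {N : ℕ}
    (e : V ⊕ P × Fin 4 ≃ Fin N) (base_lt : ∀ v q, e (.inl v) < e (.inr q))
    (consecutive : ∀ p i, (e (.inr (p, i)) : ℕ) = e (.inr (p, 0)) + i) :
    IsJSum (cayleyDet (Matrix.reindex e e (G.xorReplace f g).adjacency))
      (4 ^ Fintype.card P * ∑ T : P → Bool, (coverMatrix G.src G.tgt w f g T).det) := by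
  obtain ⟨l, hl, hl', h⟩ := exists_cayleyDet_reindex_eq e base_lt consecutive
    (G.xorReplace f g).adjacency (baseRow G f g w) (adjacency_xorReplace_inl G f g w hG)
  have hgadget : ∀ (σ : Equiv.Perm (V ⊕ P × Fin 4)) (p : P),
      ((gadgetVertices V p).map fun x => (G.xorReplace f g).adjacency x (σ x)).prod =
        portWeight F (portChoice (G.tgt ∘ f) (G.tgt ∘ g) σ p) := by
    intro σ p
    simp only [gadgetVertices, List.map_cons, List.map_nil, List.prod_cons, List.prod_nil,
      adjacency_xorReplace_inr G f g htgt, portWeight, portProdInt, portChoice, map_mul, mul_one,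
      mul_assoc]
  simp only [hgadget] at h
  have h' := sum_replace_gadgets (F := F) (G.tgt ∘ f) (G.tgt ∘ g) (baseRow G f g w)
    (fun _ _ => by simp [baseRow]) (fun _ _ => by simp [baseRow]) [] l hl hl'
  simp only [List.map_nil, List.prod_nil, one_mul, List.nil_append] at h'
  rw [h, h']
  -- The product over the gadgets of two-term sums expands into a sum over all `T`; the subdivision
  -- signs turn the factors `-4` into `4`.
  have key : 4 ^ Fintype.card P * ∑ T : P → Bool, (coverMatrix G.src G.tgt w f g T).det =
      ∑ σ : Equiv.Perm (V ⊕ P × Fin 4), Equiv.Perm.sign σ •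
        ((∏ v, baseRow G f g w v (σ (.inl v))) * (l.map fun p => (-4 : F) *
          ∑ c : Bool, ∏ j, linkRow F (G.tgt ∘ f) (G.tgt ∘ g) c p j (σ (.inr (p, j)))).prod) := by
    have hl'' : l.toFinset = Finset.univ := by ext p; simp [hl']
    have h4 : (4 : F) ^ Fintype.card P = (-4) ^ Fintype.card P * (-1) ^ Fintype.card P := by
      rw [← mul_pow]; norm_num
    rw [h4, mul_assoc, Finset.mul_sum]
    simp only [← det_linkRow G f g w hf hg hfg hwf hwg]
    rw [Finset.sum_comm, Finset.mul_sum]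
    refine Finset.sum_congr rfl fun σ _ => ?_
    rw [← List.prod_toFinset _ hl, hl'', Finset.prod_mul_distrib, Finset.prod_const,
      Finset.card_univ, Fintype.prod_sum, ← Finset.smul_sum, ← Finset.mul_sum, mul_smul_comm]
    congr 1
    ring
  rw [key]
  refine IsJSum.sum _ fun σ => IsJSum.units_smul (IsJSum.smul (IsJSum.list_prod l fun p => ?_) _) _
  exact isJSum_linkWeight _ _ htgt σ p

end Xor

/-! ### Determinants of cycles, paths and disjoint unions. -/

namespace Matrix

variable {R : Type*} [CommRing R]

/-- The determinant of the adjacency matrix of a directed cycle with self-loops at all vertices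
but the first one. -/
theorem det_cycle (n : ℕ) (a b : Fin (n + 1) → R) (h0 : a 0 = 0) :
    (of fun i j => (if i = j then a i else 0) + if i + 1 = j then b i else 0 :
      Matrix (Fin (n + 1)) (Fin (n + 1)) R).det = (-1) ^ n * ∏ i, b i := by
  set M : Matrix (Fin (n + 1)) (Fin (n + 1)) R :=
    of fun i j => (if i = j then a i else 0) + if i + 1 = j then b i else 0 with hM
  -- Rotating the columns puts the cycle edges on the diagonal and the loops directly below it. Only
  -- the loop at `0` would land in the upper right corner, hence `h0`.
  have h1 : (M.submatrix id (finRotate (n + 1))).det = ∏ i, b i := by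
    rw [det_of_isLowerTriangular]
    · refine Finset.prod_congr rfl fun i _ => ?_
      simp only [submatrix_apply, id, finRotate_apply, hM, of_apply, if_true]
      rw [add_eq_right, ite_eq_right_iff]
      intro h
      have h' : i = 0 := by
        by_contra hne
        have := Fin.val_add_one i
        rw [← h] at this
        split_ifs at this with hl
        · exact hne (Fin.ext this)
        · omega
      rw [h', h0]
    · intro i j hij
      replace hij : i < j := hij
      simp only [submatrix_apply, id, finRotate_apply, hM, of_apply, add_left_inj, hij.ne,
        if_false, add_zero, ite_eq_right_iff]
      intro h
      have := Fin.val_add_one j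
      rw [← h] at this
      split_ifs at this with hl
      · rw [show i = 0 from Fin.ext this, h0]
      · rw [Fin.lt_def] at hij
        omega
  rw [det_permute', sign_finRotate] at h1
  rw [← h1]
  simp [← mul_assoc, ← mul_pow]

theorem det_bidiagonal (n : ℕ) (a b : Fin n → R) :
    (of fun i j => (if i = j then a i else 0) + if (i : ℕ) + 1 = j then b i else 0 :
      Matrix (Fin n) (Fin n) R).det = ∏ i, a i := by
  rw [det_of_isUpperTriangular]
  · simp
  · intro i j hij
    replace hij : j < i := hij
    rw [Fin.lt_def] at hij
    have h1 : i ≠ j := by rintro rfl; omega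
    have h2 : (i : ℕ) + 1 ≠ j := by omega
    simp [h1, h2]

/-- The determinant of a block diagonal matrix. -/
theorem det_eq_prod_det_block {V ι : Type*} [Fintype V] [DecidableEq V] [Fintype ι]
    [DecidableEq ι] (A : Matrix V V R) (comp : V → ι)
    (h : ∀ v y, comp v ≠ comp y → A v y = 0) :
    A.det = ∏ i, (A.submatrix (fun v : {v // comp v = i} => v.1) fun v => v.1).det := by
  have e := Fintype.equivFin ι
  have key : A.BlockTriangular (e ∘ comp) := fun v y hvy => h v y fun h' => by
    simp [h'] at hvy
  rw [key.det_fintype, ← Equiv.prod_comp e]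
  refine Finset.prod_congr rfl fun i _ => ?_
  rw [← det_submatrix_equiv_self (Equiv.subtypeEquivRight fun v => by simp :
    {v // comp v = i} ≃ {v // (e ∘ comp) v = e i})]
  rfl

theorem det_submatrix_subtype {V X : Type*} [Fintype V] [DecidableEq V] [Fintype X] [DecidableEq X]
    {p : V → Prop} [DecidablePred p] (A : Matrix V V R) (f : X → V) (hf : Function.Injective f)
    (hp : ∀ v, p v ↔ ∃ x, f x = v) :
    (A.submatrix (fun v : {v // p v} => v.1) fun v => v.1).det = (A.submatrix f f).det := by
  let e : X ≃ {v // p v} := Equiv.ofBijective (fun x => ⟨f x, (hp _).2 ⟨x, rfl⟩⟩)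
    ⟨fun x y h => hf (congrArg Subtype.val h), fun v => by
      obtain ⟨x, hx⟩ := (hp v.1).1 v.2
      exact ⟨x, Subtype.ext hx⟩⟩
  rw [← det_submatrix_equiv_self e]
  rfl

end Matrix

/-! ### The determinant of the preliminary graph with arbitrary weights. -/

namespace ThreeSAT

variable {n m : ℕ} {F : Type*} [Field F] (φ : ThreeSAT n m)

theorem pathVertex_zero (l : Fin n × Bool) : φ.pathVertex l 0 = .start l.1 := rfl

theorem pathVertex_succ (l : Fin n × Bool) (i : Fin (φ.sideLen l)) :
    φ.pathVertex l (i + 1) = .inner l i := dif_pos i.2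

theorem pathVertex_last (l : Fin n × Bool) :
    φ.pathVertex l (φ.sideLen l + 1) = .finish l.1 := dif_neg (lt_irrefl _)

theorem pathVertex_inj {l : Fin n × Bool} {i j : ℕ} (hi : i ≤ φ.sideLen l + 1)
    (hj : j ≤ φ.sideLen l + 1) : φ.pathVertex l i = φ.pathVertex l j ↔ i = j := by
  refine ⟨fun h => ?_, fun h => by rw [h]⟩
  rcases i with _ | i <;> rcases j with _ | j <;> simp only [pathVertex] at h
  · rfl
  · split_ifs at h
  · split_ifs at h
  · split_ifs at h
    · simpa using h
    · omega

/-- The adjacency matrix of the clause gadget `j`. -/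
def clauseMatrix (w : BaseEdge φ → F) (j : Fin m) : Matrix (Fin 4) (Fin 4) F :=
  !![0, w (.clauseExt j 0) + w (.clauseForth j), 0, w (.toCentre j 0);
     w (.clauseBack j), 0, w (.clauseExt j 1), w (.toCentre j 1);
     w (.clauseExt j 2), 0, 0, w (.toCentre j 2);
     w (.fromCentre j 0), w (.fromCentre j 1), w (.fromCentre j 2), 0]

/-- The adjacency matrix of the preliminary graph without subdivision of a middle edge: the
additional vertex, if there is one, is isolated with a self-loop. -/
def cycleMatrix (w : BaseEdge φ → F) : Matrix (BaseVertex φ) (BaseVertex φ) F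
  | .start k, y => ∑ b : Bool, if φ.pathVertex (k, b) 1 = y then w (.varExt (k, b) 0) else 0
  | .finish k, y => if .start k = y then 1 else 0
  | .inner l i, y => (if .inner l i = y then w (.loop l i) else 0) +
      if φ.pathVertex l (i + 2) = y then w (.varExt l i.succ) else 0
  | .extra z, y => if .extra z = y then 1 else 0
  | .clause j c, .clause j' c' => if j = j' then clauseMatrix φ w j c c' else 0
  | .clause _ _, _ => 0

/-- The adjacency matrix of the preliminary graph with arbitrary weights. -/
def baseMatrix (L : Layout φ) (w : BaseEdge φ → F) : Matrix (BaseVertex φ) (BaseVertex φ) F :=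
  Matrix.of fun v y => ∑ e, if (φ.baseGraph F L).src e = v ∧ (φ.baseGraph F L).tgt e = y then w e
    else 0

variable (L : Layout φ) (w : BaseEdge φ → F)

theorem baseMatrix_row (v y : BaseVertex φ) (S : Finset (BaseEdge φ))
    (hS : ∀ e, (φ.baseGraph F L).src e = v ↔ e ∈ S) :
    φ.baseMatrix L w v y = ∑ e ∈ S, if (φ.baseGraph F L).tgt e = y then w e else 0 := by
  rw [baseMatrix, Matrix.of_apply]
  have : S = Finset.univ.filter fun e => (φ.baseGraph F L).src e = v := by ext; simp [hS]
  rw [this, Finset.sum_filter]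
  refine Finset.sum_congr rfl fun e _ => ?_
  rw [ite_and]

theorem src_varExt_eq (l : Fin n × Bool) (i : Fin (φ.sideLen l + 1)) :
    (φ.baseGraph F L).src (.varExt l i) = φ.pathVertex l i := rfl

theorem src_eq_start (k : Fin n) (e : BaseEdge φ) :
    (φ.baseGraph F L).src e = .start k ↔ ∃ b, e = .varExt (k, b) 0 := by
  cases e with
  | varExt l i =>
    rw [src_varExt_eq]
    obtain ⟨k', b⟩ := l
    refine Fin.cases ?_ (fun i => ?_) i
    · rw [Fin.val_zero, pathVertex_zero]
      constructor
      · rintro h; cases h; exact ⟨b, rfl⟩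
      · rintro ⟨b', h⟩; cases h; rfl
    · rw [Fin.val_succ, pathVertex_succ]
      constructor
      · rintro ⟨⟩
      · rintro ⟨b', h⟩
        simp only [BaseEdge.varExt.injEq, Prod.mk.injEq] at h
        obtain ⟨⟨rfl, rfl⟩, h⟩ := h
        exact absurd (eq_of_heq h) (Fin.succ_ne_zero i)
  | _ => simp [baseGraph]

theorem src_eq_inner (l : Fin n × Bool) (i : Fin (φ.sideLen l)) (e : BaseEdge φ) :
    (φ.baseGraph F L).src e = .inner l i ↔ e = .loop l i ∨ e = .varExt l i.succ := by
  cases e with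
  | varExt l' i' =>
    rw [src_varExt_eq]
    refine Fin.cases ?_ (fun i' => ?_) i'
    · rw [Fin.val_zero, pathVertex_zero]
      constructor
      · rintro ⟨⟩
      · rintro (h | h)
        · cases h
        · simp only [BaseEdge.varExt.injEq] at h
          obtain ⟨rfl, h⟩ := h
          exact absurd (eq_of_heq h).symm (Fin.succ_ne_zero i)
    · rw [Fin.val_succ, pathVertex_succ]
      constructor
      · rintro h; cases h; exact .inr rfl
      · rintro (h | h)
        · cases h
        · simp only [BaseEdge.varExt.injEq] at h
          obtain ⟨rfl, h⟩ := h
          rw [Fin.succ_injective _ (eq_of_heq h)]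
  | _ => simp [baseGraph]

theorem src_varExt_cases (l : Fin n × Bool) (i : Fin (φ.sideLen l + 1)) :
    (φ.baseGraph F L).src (.varExt l i) = .start l.1 ∨
      ∃ i', (φ.baseGraph F L).src (.varExt l i) = .inner l i' := by
  rw [src_varExt_eq]
  refine Fin.cases (.inl rfl) (fun i => .inr ⟨i, ?_⟩) i
  rw [Fin.val_succ, pathVertex_succ]

theorem src_eq_finish (k : Fin n) (e : BaseEdge φ) :
    (φ.baseGraph F L).src e = .finish k ↔ e = .middle k := by
  cases e with
  | varExt l i =>
    rcases φ.src_varExt_cases (F := F) L l i with h | ⟨i', h⟩ <;> simp [h]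
  | _ => simp [baseGraph]

theorem src_eq_extra (z : Fin ((n + m) % 2)) (e : BaseEdge φ) :
    (φ.baseGraph F L).src e = .extra z ↔ e = .extra z := by
  cases e with
  | varExt l i =>
    rcases φ.src_varExt_cases (F := F) L l i with h | ⟨i', h⟩ <;> simp [h]
  | _ => simp [baseGraph]

theorem src_eq_clause (j : Fin m) (c : Fin 4) (e : BaseEdge φ) :
    (φ.baseGraph F L).src e = .clause j c ↔ (∃ i : Fin 3, i.castSucc = c ∧
      (e = .clauseExt j i ∨ e = .toCentre j i)) ∨ (c = 0 ∧ e = .clauseForth j) ∨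
      (c = 1 ∧ e = .clauseBack j) ∨ (c = 3 ∧ ∃ i, e = .fromCentre j i) := by
  cases e with
  | varExt l i =>
    rcases φ.src_varExt_cases (F := F) L l i with h | ⟨i', h⟩ <;> simp [h]
  | _ => simp [baseGraph, eq_comm] <;> tauto

theorem baseMatrix_start (k : Fin n) : φ.baseMatrix L w (.start k) = φ.cycleMatrix w (.start k) := by
  funext y
  rw [baseMatrix_row φ L w _ _ {.varExt (k, true) 0, .varExt (k, false) 0}
    (fun e => by rw [src_eq_start]; simp [or_comm])]
  rw [Finset.sum_pair (by simp)]
  simp [cycleMatrix, baseGraph]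

theorem baseMatrix_inner (l : Fin n × Bool) (i : Fin (φ.sideLen l)) :
    φ.baseMatrix L w (.inner l i) = φ.cycleMatrix w (.inner l i) := by
  funext y
  rw [baseMatrix_row φ L w _ _ {.loop l i, .varExt l i.succ}
    (fun e => by rw [src_eq_inner]; simp)]
  rw [Finset.sum_pair (by simp)]
  simp [cycleMatrix, baseGraph, add_assoc, one_add_one_eq_two]
  rfl

theorem baseMatrix_clause (j : Fin m) (c : Fin 4) :
    φ.baseMatrix L w (.clause j c) = φ.cycleMatrix w (.clause j c) := by
  funext y
  fin_cases c
  · rw [baseMatrix_row φ L w _ _ {.clauseExt j 0, .toCentre j 0, .clauseForth j}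
      (fun e => by rw [src_eq_clause]; simp [Fin.exists_fin_succ]; tauto)]
    cases y with
    | clause j' c' =>
      fin_cases c' <;> by_cases h : j = j' <;> simp [cycleMatrix, baseGraph, h, clauseMatrix]
    | _ => simp [cycleMatrix, baseGraph]
  · rw [baseMatrix_row φ L w _ _ {.clauseExt j 1, .toCentre j 1, .clauseBack j}
      (fun e => by rw [src_eq_clause]; simp [Fin.exists_fin_succ]; try tauto)]
    cases y with
    | clause j' c' =>
      fin_cases c' <;> by_cases h : j = j' <;> simp [cycleMatrix, baseGraph, h, clauseMatrix]
    | _ => simp [cycleMatrix, baseGraph]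
  · rw [baseMatrix_row φ L w _ _ {.clauseExt j 2, .toCentre j 2}
      (fun e => by rw [src_eq_clause]; simp [Fin.exists_fin_succ]; try tauto)]
    cases y with
    | clause j' c' =>
      fin_cases c' <;> by_cases h : j = j' <;> simp [cycleMatrix, baseGraph, h, clauseMatrix]
    | _ => simp [cycleMatrix, baseGraph]
  · rw [baseMatrix_row φ L w _ _ {.fromCentre j 0, .fromCentre j 1, .fromCentre j 2}
      (fun e => by rw [src_eq_clause]; simp [Fin.exists_fin_succ]; try tauto)]
    cases y with
    | clause j' c' =>
      fin_cases c' <;> by_cases h : j = j' <;> simp [cycleMatrix, baseGraph, h, clauseMatrix]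
    | _ => simp [cycleMatrix, baseGraph]

end ThreeSAT

namespace ThreeSAT

variable {n m : ℕ} {F : Type*} [Field F] (φ : ThreeSAT n m) (L : Layout φ) (w : BaseEdge φ → F)

theorem baseMatrix_finish (hw : ∀ k, w (.middle k) = 1) (k : Fin n)
    (hk : ∀ z, L.extraAt z ≠ k) :
    φ.baseMatrix L w (.finish k) = φ.cycleMatrix w (.finish k) := by
  funext y
  rw [baseMatrix_row φ L w _ _ {.middle k} (fun e => by rw [src_eq_finish]; simp)]
  simp [cycleMatrix, baseGraph, hk, hw]

theorem baseMatrix_finish_extraAt (hw : ∀ k, w (.middle k) = 1) (z : Fin ((n + m) % 2)) :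
    φ.baseMatrix L w (.finish (L.extraAt z)) = Pi.single (.extra z) 1 := by
  funext y
  rw [baseMatrix_row φ L w _ _ {.middle (L.extraAt z)} (fun e => by rw [src_eq_finish]; simp)]
  have h : ∃ z', L.extraAt z' = L.extraAt z := ⟨z, rfl⟩
  have hz : (⟨0, z.pos⟩ : Fin ((n + m) % 2)) = z := Fin.ext (by simp; omega)
  simp [baseGraph, hw, Pi.single_apply, hz, eq_comm]

theorem baseMatrix_extra (hw : ∀ z, w (.extra z) = 1) (z : Fin ((n + m) % 2)) :
    φ.baseMatrix L w (.extra z) = Pi.single (.start (L.extraAt z)) 1 := by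
  funext y
  rw [baseMatrix_row φ L w _ _ {.extra z} (fun e => by rw [src_eq_extra]; simp)]
  simp [baseGraph, hw, Pi.single_apply, eq_comm]

theorem pathVertex_ne_extra (l : Fin n × Bool) (i : ℕ) (z : Fin ((n + m) % 2)) :
    φ.pathVertex l i ≠ .extra z := by
  cases i with
  | zero => rintro ⟨⟩
  | succ i =>
    rw [pathVertex]
    split_ifs <;> rintro ⟨⟩

theorem pathVertex_ne_inner_not (k : Fin n) (b : Bool) (i : ℕ) (i' : Fin (φ.sideLen (k, !b))) :
    φ.pathVertex (k, b) i ≠ .inner (k, !b) i' := by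
  intro h
  cases i with
  | zero => cases h
  | succ i =>
    rw [pathVertex] at h
    split_ifs at h
    simp only [BaseVertex.inner.injEq, Prod.mk.injEq] at h
    simpa using h.1.2

/-- The additional vertex, if present, has a single entering edge, namely the redirected middle
edge. It is eliminated like any subdivision, at the cost of one sign. -/
theorem det_baseMatrix_eq_det_cycleMatrix (hm : ∀ k, w (.middle k) = 1)
    (he : ∀ z, w (.extra z) = 1) :
    (φ.baseMatrix L w).det = (-1) ^ ((n + m) % 2) * (φ.cycleMatrix w).det := by
  by_cases hz : Nonempty (Fin ((n + m) % 2))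
  · obtain ⟨z⟩ := hz
    have hcard : (n + m) % 2 = 1 := by have := z.2; omega
    have huniq : ∀ z', z' = z := fun z' => Fin.ext (by omega)
    rw [Matrix.det_eq_neg_of_col_supported (φ.baseMatrix L w) (x := .extra z)
      (z := .finish (L.extraAt z)) (by simp), baseMatrix_finish_extraAt φ L w hm, hcard]
    · rw [Pi.single_eq_same, one_mul, pow_one, neg_one_mul]
      congr 2
      ext v y
      by_cases hv : v = .extra z
      · subst hv
        simp [cycleMatrix, Pi.single_apply, eq_comm]
      rw [Matrix.updateRow_ne hv]
      by_cases hv' : v = .finish (L.extraAt z)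
      · subst hv'
        rw [Matrix.updateRow_self, baseMatrix_extra φ L w he]
        simp [cycleMatrix, Pi.single_apply, eq_comm]
      rw [Matrix.updateRow_ne hv']
      cases v with
      | start k => rw [baseMatrix_start]
      | finish k =>
        rw [baseMatrix_finish φ L w hm]
        rintro z' rfl
        exact hv' (by rw [huniq z'])
      | inner l i => rw [baseMatrix_inner]
      | clause j c => rw [baseMatrix_clause]
      | extra z' => exact absurd (by rw [huniq z']) hv
    · intro v hv
      cases v with
      | start k => rw [baseMatrix_start]; simp [cycleMatrix, pathVertex_ne_extra]
      | finish k =>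
        rw [baseMatrix_finish φ L w hm]
        · simp [cycleMatrix]
        · rintro z' rfl
          exact hv (by rw [huniq z'])
      | inner l i => rw [baseMatrix_inner]; simp [cycleMatrix, pathVertex_ne_extra]
      | clause j c => rw [baseMatrix_clause]; simp [cycleMatrix]
      | extra z' => rw [baseMatrix_extra φ L w he]; simp
  · have hz' : ∀ z : Fin ((n + m) % 2), False := fun z => hz ⟨z⟩
    have hcard : (n + m) % 2 = 0 := by
      by_contra h
      exact hz ⟨⟨0, by omega⟩⟩
    rw [hcard, pow_zero, one_mul]
    congr 1
    ext v y
    cases v with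
    | start k => rw [baseMatrix_start]
    | finish k => rw [baseMatrix_finish φ L w hm k fun z => (hz' z).elim]
    | inner l i => rw [baseMatrix_inner]
    | clause j c => rw [baseMatrix_clause]
    | extra z => exact (hz' z).elim

/-- The gadget (or additional vertex) a vertex belongs to. -/
def component : BaseVertex φ → (Fin n ⊕ Fin m) ⊕ Fin ((n + m) % 2)
  | .start k => .inl (.inl k)
  | .finish k => .inl (.inl k)
  | .inner l _ => .inl (.inl l.1)
  | .clause j _ => .inl (.inr j)
  | .extra z => .inr z

theorem component_pathVertex (l : Fin n × Bool) (i : ℕ) :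
    component φ (φ.pathVertex l i) = .inl (.inl l.1) := by
  cases i with
  | zero => rfl
  | succ i =>
    rw [pathVertex]
    split_ifs <;> rfl

theorem cycleMatrix_eq_zero (v y : BaseVertex φ) (h : component φ v ≠ component φ y) :
    φ.cycleMatrix w v y = 0 := by
  cases v with
  | start k =>
    refine Finset.sum_eq_zero fun b _ => if_neg ?_
    rintro rfl
    exact h (component_pathVertex φ (k, b) 1).symm
  | finish k => exact if_neg (by rintro rfl; exact h rfl)
  | inner l i =>
    simp only [cycleMatrix]
    rw [if_neg (by rintro rfl; exact h rfl), if_neg, add_zero]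
    rintro rfl
    exact h (component_pathVertex φ l _).symm
  | extra z => exact if_neg (by rintro rfl; exact h rfl)
  | clause j c =>
    cases y with
    | clause j' c' => exact if_neg (by rintro rfl; exact h rfl)
    | _ => rfl

/-- The vertices of the variable gadget `k`: the path along the side of `(k, b)`, and the interior
vertices of the other side. -/
def variableVertex (k : Fin n) (b : Bool) :
    Fin (φ.sideLen (k, b) + 1 + 1) ⊕ Fin (φ.sideLen (k, !b)) → BaseVertex φ
  | .inl i => φ.pathVertex (k, b) i
  | .inr i => .inner (k, !b) i

theorem variableVertex_injective (k : Fin n) (b : Bool) :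
    Function.Injective (φ.variableVertex k b) := by
  rintro (i | i) (j | j) h
  · rw [variableVertex, variableVertex, pathVertex_inj φ (by omega) (by omega)] at h
    rw [Fin.ext h]
  · exact (pathVertex_ne_inner_not φ _ _ _ _ h).elim
  · exact (pathVertex_ne_inner_not φ _ _ _ _ h.symm).elim
  · simp only [variableVertex, BaseVertex.inner.injEq] at h
    rw [eq_of_heq h.2]

theorem component_eq_variable_iff (k : Fin n) (b : Bool) (v : BaseVertex φ) :
    component φ v = .inl (.inl k) ↔ ∃ x, φ.variableVertex k b x = v := by
  constructor
  · cases v with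
    | start k' =>
      intro h
      simp only [component, Sum.inl.injEq] at h
      subst h
      exact ⟨.inl 0, rfl⟩
    | finish k' =>
      intro h
      simp only [component, Sum.inl.injEq] at h
      subst h
      exact ⟨.inl (Fin.last _), φ.pathVertex_last _⟩
    | inner l i =>
      intro h
      obtain ⟨k', b'⟩ := l
      simp only [component, Sum.inl.injEq] at h
      subst h
      by_cases hb : b' = b
      · subst hb
        exact ⟨.inl i.succ.castSucc, φ.pathVertex_succ _ i⟩
      · obtain rfl : b' = !b := by cases b <;> cases b' <;> simp_all
        exact ⟨.inr i, rfl⟩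
    | clause j c => intro h; cases h
    | extra z => intro h; cases h
  · rintro ⟨x | x, rfl⟩
    · exact component_pathVertex φ _ _
    · rfl

theorem even_sideLen (l : Fin n × Bool) : Even (φ.sideLen l) := even_two_mul _

/-- The contribution of one side of a variable gadget. -/
theorem det_variable_side (k : Fin n) (b : Bool) (hw : w (.varExt (k, !b) 0) = 0) :
    ((φ.cycleMatrix w).submatrix (φ.variableVertex k b) (φ.variableVertex k b)).det =
      -((∏ i, w (.varExt (k, b) i)) * ∏ i, w (.loop (k, !b) i)) := by
  set s := φ.sideLen (k, b) with hs
  -- The start and end vertices have no self-loop; the cycle is closed by the middle edge of weight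
  -- 1.
  let loopW : Fin (s + 1 + 1) → F := Fin.cons 0 (Fin.snoc (fun i => w (.loop (k, b) i)) 0)
  let edgeW : Fin (s + 1 + 1) → F := Fin.snoc (fun i => w (.varExt (k, b) i)) 1
  -- As the first edge of the other side has weight zero, no vertex of the cycle leads into that
  -- side, and the matrix is block triangular.
  have key : (φ.cycleMatrix w).submatrix (φ.variableVertex k b) (φ.variableVertex k b) =
      Matrix.fromBlocks
        (Matrix.of fun i j => (if i = j then loopW i else 0) + if i + 1 = j then edgeW i else 0) 0
        ((φ.cycleMatrix w).submatrix (φ.variableVertex k b ∘ .inr) (φ.variableVertex k b ∘ .inl))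
        (Matrix.of fun i j => (if i = j then w (.loop (k, !b) i) else 0) +
          if (i : ℕ) + 1 = j then w (.varExt (k, !b) i.succ) else 0) := by
    have hstart : ∀ y, φ.cycleMatrix w (.start k) y =
        if φ.pathVertex (k, b) 1 = y then w (.varExt (k, b) 0) else 0 := by
      intro y
      refine Fintype.sum_eq_single b fun b' hb' => ?_
      obtain rfl : b' = !b := by cases b <;> cases b' <;> simp_all
      rw [hw, ite_self]
    have hcase : ∀ i : Fin (s + 1 + 1), i = 0 ∨ (∃ i' : Fin s, i = i'.castSucc.succ) ∨
        i = Fin.last _ := by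
      intro i
      refine Fin.cases (.inl rfl) (fun i => ?_) i
      refine Fin.lastCases (.inr (.inr rfl)) (fun i => .inr (.inl ⟨i, rfl⟩)) i
    ext (i | i) (j | j)
    · simp only [Matrix.submatrix_apply, Matrix.fromBlocks_apply₁₁, Matrix.of_apply, variableVertex]
      rcases hcase i with rfl | ⟨i, rfl⟩ | rfl
      · rw [Fin.val_zero, pathVertex_zero, hstart]
        have h1 : edgeW 0 = w (.varExt (k, b) 0) :=
          Fin.snoc_castSucc (α := fun _ => F) 1 (fun i => w (.varExt (k, b) i)) 0
        have h2 : loopW 0 = 0 := rfl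
        rw [h1, h2, ite_self, zero_add, zero_add]
        exact if_congr (by rw [pathVertex_inj φ (by omega) (by omega), Fin.ext_iff]; simp) rfl rfl
      · have h1 : edgeW i.castSucc.succ = w (.varExt (k, b) i.succ) :=
          Fin.snoc_castSucc (α := fun _ => F) 1 (fun i => w (.varExt (k, b) i)) i.succ
        have h2 : loopW i.castSucc.succ = w (.loop (k, b) i) := by simp [loopW]
        rw [h1, h2]
        have h3 : φ.pathVertex (k, b) (i.castSucc.succ : Fin (s + 1 + 1)) = .inner (k, b) i :=
          φ.pathVertex_succ _ i
        rw [h3]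
        simp only [cycleMatrix]
        rw [← pathVertex_succ]
        have hi := i.2
        have h4 : ((i.castSucc.succ + 1 : Fin (s + 1 + 1)) : ℕ) = i + 2 := by
          rw [Fin.val_add_one_of_lt]
          · simp
          · rw [Fin.lt_def]; simp
        congr 1
        · exact if_congr (by rw [pathVertex_inj φ (by omega) (by omega), Fin.ext_iff]; simp) rfl rfl
        · exact if_congr (by
            rw [pathVertex_inj φ (by omega) (by omega), Fin.ext_iff, h4]) rfl rfl
      · have h1 : edgeW (Fin.last _) = 1 := by simp [edgeW]
        have h2 : loopW (Fin.last _) = 0 := by simp [loopW, ← Fin.succ_last]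
        rw [h1, h2, Fin.val_last, pathVertex_last, ite_self, zero_add, Fin.last_add_one]
        simp only [cycleMatrix]
        refine if_congr ?_ rfl rfl
        have h3 : BaseVertex.start k = φ.pathVertex (k, b) 0 := rfl
        rw [h3, pathVertex_inj φ (by omega) (by omega), Fin.ext_iff, Fin.val_zero]
    · simp only [Matrix.submatrix_apply, Matrix.fromBlocks_apply₁₂, variableVertex,
        Matrix.zero_apply]
      rcases hcase i with rfl | ⟨i, rfl⟩ | rfl
      · rw [Fin.val_zero, pathVertex_zero, hstart, if_neg (pathVertex_ne_inner_not φ _ _ _ _)]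
      · have h3 : φ.pathVertex (k, b) (i.castSucc.succ : Fin (s + 1 + 1)) = .inner (k, b) i :=
          φ.pathVertex_succ _ i
        rw [h3]
        simp only [cycleMatrix]
        rw [← pathVertex_succ, if_neg (pathVertex_ne_inner_not φ _ _ _ _),
          if_neg (pathVertex_ne_inner_not φ _ _ _ _), add_zero]
      · rw [Fin.val_last, pathVertex_last]
        simp [cycleMatrix]
    · rfl
    · simp only [Matrix.submatrix_apply, Matrix.fromBlocks_apply₂₂, Matrix.of_apply,
        variableVertex, cycleMatrix]
      congr 1
      · exact if_congr (by simp) rfl rfl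
      · rw [← pathVertex_succ]
        have hi := i.2
        exact if_congr (by rw [pathVertex_inj φ (by omega) (by omega)]; omega) rfl rfl
  rw [key, Matrix.det_fromBlocks_zero₁₂, Matrix.det_cycle _ _ _ rfl, Matrix.det_bidiagonal,
    Fin.prod_univ_castSucc]
  -- The cycle has `s + 2` vertices, and `s` is even.
  have hpow : (-1 : F) ^ (s + 1) = -1 := (φ.even_sideLen (k, b)).add_one.neg_one_pow
  simp only [edgeW, hpow, Fin.snoc_castSucc, Fin.snoc_last, mul_one, neg_mul, one_mul]
  rfl

/-- The determinant is linear in the row of the start vertex, whose two outgoing edges open the two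
sides. Each summand is the gadget with one side switched off. -/
theorem det_variable (k : Fin n) :
    ((φ.cycleMatrix w).submatrix (fun v : {v // component φ v = .inl (.inl k)} => v.1)
      fun v => v.1).det =
      -∑ b : Bool, (∏ i, w (.varExt (k, b) i)) * ∏ i, w (.loop (k, !b) i) := by
  let row : Bool → {v // component φ v = .inl (.inl k)} → F := fun b y =>
    if φ.pathVertex (k, b) 1 = y.1 then w (.varExt (k, b) 0) else 0
  have hrow : ∀ b, (Matrix.updateRow ((φ.cycleMatrix w).submatrix
      (fun v : {v // component φ v = .inl (.inl k)} => v.1) fun v => v.1)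
      ⟨.start k, rfl⟩ (row b)).det =
      -((∏ i, w (.varExt (k, b) i)) * ∏ i, w (.loop (k, !b) i)) := by
    intro b
    classical
    let w' : BaseEdge φ → F := Function.update w (.varExt (k, !b) 0) 0
    have h1 : ∀ i, w' (.varExt (k, b) i) = w (.varExt (k, b) i) := fun i =>
      Function.update_of_ne (by simp) _ _
    have h2 : ∀ i, w' (.loop (k, !b) i) = w (.loop (k, !b) i) := fun i =>
      Function.update_of_ne (by simp) _ _
    have h3 := det_variable_side φ w' k b (Function.update_self ..)
    simp only [h1, h2] at h3
    rw [← h3, ← Matrix.det_submatrix_subtype _ _ (variableVertex_injective φ k b)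
      (component_eq_variable_iff φ k b)]
    congr 1
    ext ⟨v, hv⟩ y
    by_cases hvs : v = .start k
    · subst hvs
      rw [Matrix.updateRow_self]
      simp only [Matrix.submatrix_apply, cycleMatrix, row, w']
      rw [Fintype.sum_eq_single b, Function.update_of_ne (by simp)]
      intro b' hb'
      obtain rfl : b' = !b := by cases b <;> cases b' <;> simp_all
      rw [Function.update_self, ite_self]
    · rw [Matrix.updateRow_ne fun h => hvs (congrArg Subtype.val h)]
      simp only [Matrix.submatrix_apply, w']
      cases v with
      | start k' =>
        simp only [component, Sum.inl.injEq] at hv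
        exact absurd (by rw [hv]) hvs
      | finish k' => rfl
      | inner l i =>
        simp only [cycleMatrix]
        rw [Function.update_of_ne (by simp), Function.update_of_ne]
        intro h
        simp only [BaseEdge.varExt.injEq] at h
        obtain ⟨rfl, h⟩ := h
        exact Fin.succ_ne_zero _ (eq_of_heq h)
      | clause j c => cases hv
      | extra z => rfl
  have hsplit : (φ.cycleMatrix w).submatrix
      (fun v : {v // component φ v = .inl (.inl k)} => v.1) (fun v => v.1) =
      Matrix.updateRow ((φ.cycleMatrix w).submatrix
      (fun v : {v // component φ v = .inl (.inl k)} => v.1) fun v => v.1)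
      ⟨.start k, rfl⟩ (row true + row false) := by
    ext v y
    by_cases hv : v = ⟨.start k, rfl⟩
    · subst hv
      rw [Matrix.updateRow_self]
      simp [cycleMatrix, row]
    · rw [Matrix.updateRow_ne hv]
  rw [hsplit, Matrix.det_updateRow_add, hrow, hrow, Fintype.sum_bool]
  ring

theorem det_cycleMatrix :
    (φ.cycleMatrix w).det =
      (∏ k, -∑ b : Bool, (∏ i, w (.varExt (k, b) i)) * ∏ i, w (.loop (k, !b) i)) *
        ∏ j, (φ.clauseMatrix w j).det := by
  rw [Matrix.det_eq_prod_det_block _ (component φ) (cycleMatrix_eq_zero φ w),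
    Fintype.prod_sum_type, Fintype.prod_sum_type]
  have h1 : ∏ z, ((φ.cycleMatrix w).submatrix (fun v : {v // component φ v = .inr z} => v.1)
      fun v => v.1).det = 1 := by
    refine Finset.prod_eq_one fun z _ => ?_
    rw [Matrix.det_submatrix_subtype _ (fun _ : Unit => BaseVertex.extra z)
      (fun _ _ _ => rfl), Matrix.det_unique]
    · simp [cycleMatrix]
    · intro v
      cases v <;> simp [component, eq_comm]
  rw [h1, mul_one]
  congr 1
  · exact Finset.prod_congr rfl fun k _ => det_variable φ w k
  · refine Finset.prod_congr rfl fun j _ => ?_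
    rw [Matrix.det_submatrix_subtype _ (fun c : Fin 4 => BaseVertex.clause j c)
      (fun _ _ h => by simpa using h)]
    · congr 1
      ext c c'
      simp [cycleMatrix]
    · intro v
      cases v <;> simp [component, eq_comm]

end ThreeSAT

/-! ### Forced edges and truth assignments. -/

namespace ThreeSAT

variable {n m : ℕ} {F : Type*} [Field F] (φ : ThreeSAT n m) (L : Layout φ)

/-- The weights of the edges of the preliminary graph, as elements of the field. -/
def edgeWeight (F : Type*) [Field F] (φ : ThreeSAT n m) : BaseEdge φ → F
  | .clauseBack _ => -1
  | _ => 1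

/-- The external edge of the clause gadget for the literal instance `p`. -/
def clauseEdge (p : Fin m × Fin 3) : BaseEdge φ := .clauseExt p.1 p.2

/-- The external edge of the variable gadget assigned to the literal instance `p`. -/
def variableEdge (p : Fin m × Fin 3) : BaseEdge φ := .varExt (φ p.1 p.2) (L.slot p)

/-- The edge that is used for the literal instance `p`. -/
def usedEdge (U : Fin m × Fin 3 → Bool) (p : Fin m × Fin 3) : BaseEdge φ :=
  if U p then clauseEdge φ p else variableEdge φ L p

/-- The edge that is not used for the literal instance `p`. -/
def unusedEdge (U : Fin m × Fin 3 → Bool) (p : Fin m × Fin 3) : BaseEdge φ :=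
  if U p then variableEdge φ L p else clauseEdge φ p

/-- The weights of the preliminary graph, when precisely the clause edges of the literal
instances `p` with `U p`, and the variable edges of the others, must be used. -/
def coverWeight (F : Type*) [Field F] (φ : ThreeSAT n m) (L : Layout φ)
    (U : Fin m × Fin 3 → Bool) : BaseEdge φ → F :=
  forcedWeight (φ.baseGraph F L).src (edgeWeight F φ) (φ.usedEdge L U) (φ.unusedEdge L U)
    Finset.univ

variable (U : Fin m × Fin 3 → Bool)

variable {φ L U} in
theorem coverWeight_eq {e : BaseEdge φ}
    (h : ∀ p, (φ.baseGraph F L).src (φ.usedEdge L U p) = (φ.baseGraph F L).src e →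
      φ.usedEdge L U p = e) (h' : ∀ p, φ.unusedEdge L U p ≠ e) :
    coverWeight F φ L U e = edgeWeight F φ e :=
  if_pos ⟨fun p _ => h p, fun p hp => (hp (Finset.mem_univ p)).elim, h'⟩

variable {φ L U} in
theorem coverWeight_eq_zero_of_src {e : BaseEdge φ} (p : Fin m × Fin 3)
    (h : (φ.baseGraph F L).src (φ.usedEdge L U p) = (φ.baseGraph F L).src e)
    (h' : φ.usedEdge L U p ≠ e) : coverWeight F φ L U e = 0 :=
  if_neg fun h'' => h' (h''.1 p (Finset.mem_univ p) h)

variable {φ L U} in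
theorem coverWeight_eq_zero_of_unused {e : BaseEdge φ} (p : Fin m × Fin 3)
    (h : φ.unusedEdge L U p = e) : coverWeight F φ L U e = 0 :=
  if_neg fun h'' => h''.2.2 p h

/-- Among the edges leaving an outer clause vertex only the external one belongs to an XOR pair, so
the others survive exactly when that one is not forced. -/
theorem coverWeight_of_src_clause (j : Fin m) (i : Fin 3) (e : BaseEdge φ)
    (he : (φ.baseGraph F L).src e = .clause j i.castSucc) (hne : e ≠ .clauseExt j i) :
    coverWeight F φ L U e = if U (j, i) then 0 else edgeWeight F φ e := by
  have hvar : ∀ p, (φ.baseGraph F L).src (variableEdge φ L p) ≠ .clause j i.castSucc := by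
    intro p h
    rcases φ.src_varExt_cases (F := F) L (φ p.1 p.2) (L.slot p) with h' | ⟨i', h'⟩ <;>
      cases h'.symm.trans h
  have hcl : ∀ p, (φ.baseGraph F L).src (clauseEdge φ p) = .clause j i.castSucc → p = (j, i) := by
    rintro ⟨j', i'⟩ h
    simpa [baseGraph, clauseEdge] using h
  split_ifs with h
  · refine coverWeight_eq_zero_of_src (j, i) ?_ ?_
    · rw [usedEdge, if_pos h, he]
      rfl
    · rw [usedEdge, if_pos h]
      exact hne.symm
  · refine coverWeight_eq (fun p hp => ?_) fun p hp => ?_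
    · rw [he, usedEdge] at hp
      split_ifs at hp with h'
      · rw [hcl p hp] at h'
        exact absurd h' h
      · exact absurd hp (hvar p)
    · rw [unusedEdge] at hp
      split_ifs at hp with h'
      · exact hvar p (by rw [hp, he])
      · have := hcl p (by rw [hp, he])
        subst this
        exact hne hp.symm

theorem coverWeight_clauseExt (j : Fin m) (i : Fin 3) :
    coverWeight F φ L U (.clauseExt j i) = if U (j, i) then 1 else 0 := by
  split_ifs with h
  · refine coverWeight_eq (fun p hp => ?_) fun p hp => ?_
    · rw [usedEdge] at hp ⊢
      split_ifs at hp ⊢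
      · have : p = (j, i) := by
          simpa [baseGraph, clauseEdge, Prod.ext_iff] using hp
        rw [this, clauseEdge]
      · rcases φ.src_varExt_cases (F := F) L (φ p.1 p.2) (L.slot p) with h' | ⟨i', h'⟩ <;>
          cases h'.symm.trans hp
    · rw [unusedEdge] at hp
      split_ifs at hp with h'
      · cases hp
      · cases hp
        exact h' h
  · refine coverWeight_eq_zero_of_unused (j, i) ?_
    rw [unusedEdge, if_neg h]
    rfl

theorem coverWeight_of_src_ne (e : BaseEdge φ)
    (h1 : ∀ k, (φ.baseGraph F L).src e ≠ .start k)
    (h2 : ∀ l i, (φ.baseGraph F L).src e ≠ .inner l i)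
    (h3 : ∀ j (i : Fin 3), (φ.baseGraph F L).src e ≠ .clause j i.castSucc) :
    coverWeight F φ L U e = edgeWeight F φ e := by
  have hc : ∀ p, (φ.baseGraph F L).src (clauseEdge φ p) ≠ (φ.baseGraph F L).src e :=
    fun p h => h3 p.1 p.2 h.symm
  have hv : ∀ p, (φ.baseGraph F L).src (variableEdge φ L p) ≠ (φ.baseGraph F L).src e := by
    intro p h
    rcases φ.src_varExt_cases (F := F) L (φ p.1 p.2) (L.slot p) with h' | ⟨i', h'⟩
    · exact h1 _ (h.symm.trans h')
    · exact h2 _ _ (h.symm.trans h')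
  refine coverWeight_eq (fun p hp => ?_) fun p hp => ?_
  · rw [usedEdge] at hp
    split_ifs at hp
    · exact absurd hp (hc p)
    · exact absurd hp (hv p)
  · rw [unusedEdge] at hp
    split_ifs at hp
    · exact hv p (by rw [hp])
    · exact hc p (by rw [hp])

/-- A clause gadget has cycle covers, of total weight `-1`, unless all its external edges have to
be used. -/
theorem det_clauseMatrix_coverWeight (j : Fin m) :
    (clauseMatrix φ (coverWeight F φ L U) j).det = -(if ∃ i, U (j, i) = false then 1 else 0) := by
  have hto : ∀ i, coverWeight F φ L U (.toCentre j i) = if U (j, i) then 0 else 1 := fun i =>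
    coverWeight_of_src_clause φ L U j i _ rfl (by simp)
  have hforth : coverWeight F φ L U (.clauseForth j) = if U (j, 0) then 0 else 1 :=
    coverWeight_of_src_clause φ L U j 0 _ rfl (by simp)
  have hback : coverWeight F φ L U (.clauseBack j) = if U (j, 1) then 0 else -1 :=
    coverWeight_of_src_clause φ L U j 1 _ rfl (by simp)
  have hfrom : ∀ i, coverWeight F φ L U (.fromCentre j i) = 1 := fun i =>
    coverWeight_of_src_ne φ L U _ (by simp [baseGraph]) (by simp [baseGraph]) (fun j' i' h => by
      simp only [baseGraph, BaseVertex.clause.injEq, Fin.ext_iff, Fin.val_castSucc] at h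
      have := i'.2
      have h3 : ((3 : Fin 4) : ℕ) = 3 := rfl
      omega)
  have hex : (∃ i, U (j, i) = false) ↔
      (U (j, 0) = false ∨ U (j, 1) = false ∨ U (j, 2) = false) := by
    simp [Fin.exists_fin_succ]
  simp only [clauseMatrix, hto, hforth, hback, hfrom, coverWeight_clauseExt, hex]
  have h3 : (-1 : F) ^ 3 = -1 := by norm_num
  -- If all three external edges are forced, nothing enters the centre and its column vanishes; the
  -- other seven cases each give `-1`.
  cases U (j, 0) <;> cases U (j, 1) <;> cases U (j, 2) <;>
    simp [Matrix.det_succ_row_zero, Fin.sum_univ_succ, Fin.succAbove, h3]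

/-- Precisely the variable edges of the literal instances on the side of `b` are used in the
variable gadget `k`. -/
def Compatible (k : Fin n) (b : Bool) : Prop :=
  ∀ p : Fin m × Fin 3, (φ p.1 p.2).1 = k → U p = ((φ p.1 p.2).2 != b)

instance (k : Fin n) (b : Bool) : Decidable (Compatible φ U k b) :=
  inferInstanceAs (Decidable (∀ p : Fin m × Fin 3, (φ p.1 p.2).1 = k → U p = ((φ p.1 p.2).2 != b)))

/-- The left side is nonzero only if no external edge on the side of `b` is forbidden or displaced,
and no loop on the other side is displaced by a forced edge. This settles `U` at every instance of
the variable. -/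
theorem prod_side_coverWeight (k : Fin n) (b : Bool) :
    (∏ i, coverWeight F φ L U (.varExt (k, b) i)) *
      ∏ i, coverWeight F φ L U (.loop (k, !b) i) = if Compatible φ U k b then 1 else 0 := by
  split_ifs with h
  · have hused : ∀ p, (φ p.1 p.2).1 = k → U p = false → φ p.1 p.2 = (k, b) := by
      intro p hp hU
      have := h p hp
      rw [hU] at this
      refine Prod.ext hp ?_
      simpa using this.symm
    rw [Finset.prod_eq_one, Finset.prod_eq_one, one_mul]
    · intro i _
      refine coverWeight_eq (fun p hp => ?_) fun _ hp => ?_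
      · replace hp := hp.trans (show _ = BaseVertex.inner (k, !b) i from rfl)
        rw [usedEdge] at hp
        split_ifs at hp with hU
        · cases hp
        · rw [src_eq_inner] at hp
          rcases hp with hp | hp
          · cases hp
          · simp only [variableEdge, BaseEdge.varExt.injEq] at hp
            have h1 := hused p (by rw [hp.1]) (by simpa using hU)
            rw [hp.1] at h1
            simp at h1
      · rw [unusedEdge] at hp
        split_ifs at hp <;> cases hp
    · intro i _
      refine coverWeight_eq (fun p hp => ?_) fun p hp => ?_
      · rw [usedEdge] at hp ⊢
        split_ifs at hp ⊢ with hU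
        · rcases φ.src_varExt_cases (F := F) L (k, b) i with h' | ⟨i', h'⟩ <;>
            cases hp.trans h'
        · have hk : (φ p.1 p.2).1 = k := by
            have h1 : component φ ((φ.baseGraph F L).src (variableEdge φ L p)) =
              .inl (.inl (φ p.1 p.2).1) := component_pathVertex φ _ _
            have h2 : component φ ((φ.baseGraph F L).src (.varExt (k, b) i)) =
              .inl (.inl k) := component_pathVertex φ _ _
            rw [hp, h2] at h1
            simpa using h1.symm
          have h1 := hused p hk (by simpa using hU)
          rw [variableEdge] at hp ⊢
          generalize L.slot p = t at hp
          revert t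
          rw [h1]
          intro t hp
          rw [src_varExt_eq, src_varExt_eq, pathVertex_inj φ (by omega) (by omega)] at hp
          rw [Fin.ext hp]
      · rw [unusedEdge] at hp
        split_ifs at hp with hU
        · simp only [variableEdge, BaseEdge.varExt.injEq] at hp
          have := h p (by rw [hp.1])
          simp [hU, hp.1] at this
        · cases hp
  · simp only [Compatible] at h
    push Not at h
    obtain ⟨p, hk, hU⟩ := h
    by_cases hb : (φ p.1 p.2).2 = b
    · have hl : φ p.1 p.2 = (k, b) := Prod.ext hk hb
      have hU' : U p = true := by simpa [hb] using hU
      obtain ⟨t, ht⟩ : ∃ t, variableEdge φ L p = .varExt (k, b) t := by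
        rw [variableEdge]
        generalize L.slot p = t
        revert t
        rw [hl]
        exact fun t => ⟨t, rfl⟩
      rw [Finset.prod_eq_zero (Finset.mem_univ t), zero_mul]
      exact coverWeight_eq_zero_of_unused p (by rw [unusedEdge, if_pos hU', ht])
    · have hb' : (φ p.1 p.2).2 = !b := by
        revert hb
        generalize (φ p.1 p.2).2 = c
        cases b <;> cases c <;> simp
      have hl : φ p.1 p.2 = (k, !b) := Prod.ext hk hb'
      have hU' : ¬ U p = true := by
        rw [hb'] at hU
        cases b <;> simpa using hU
      obtain ⟨t, ht⟩ : ∃ t, variableEdge φ L p = .varExt (k, !b) t := by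
        rw [variableEdge]
        generalize L.slot p = t
        revert t
        rw [hl]
        exact fun t => ⟨t, rfl⟩
      have hused : φ.usedEdge L U p = .varExt (k, !b) t := by rw [usedEdge, if_neg hU', ht]
      -- A forced edge on the wrong side competes with the first edge of the side of `b` if it
      -- leaves the start vertex, and with the self-loop at its source otherwise.
      rcases Fin.eq_zero_or_eq_succ t with rfl | ⟨i, rfl⟩
      · rw [Finset.prod_eq_zero (Finset.mem_univ 0), zero_mul]
        refine coverWeight_eq_zero_of_src p ?_ ?_
        · rw [hused, src_varExt_eq, src_varExt_eq]
          rfl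
        · rw [hused]
          simp
      · rw [mul_comm, Finset.prod_eq_zero (Finset.mem_univ i), zero_mul]
        refine coverWeight_eq_zero_of_src p ?_ ?_
        · rw [hused, src_varExt_eq, Fin.val_succ, pathVertex_succ]
          rfl
        · rw [hused]
          simp

theorem det_baseMatrix_coverWeight :
    (φ.baseMatrix L (coverWeight F φ L U)).det =
      (∏ k, ∑ b : Bool, if Compatible φ U k b then 1 else 0) *
        ∏ j, if ∃ i, U (j, i) = false then 1 else 0 := by
  rw [det_baseMatrix_eq_det_cycleMatrix, det_cycleMatrix]
  · simp only [prod_side_coverWeight, det_clauseMatrix_coverWeight, Finset.prod_neg,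
      Finset.card_univ, Fintype.card_fin]
    -- One sign per variable gadget, one per clause gadget, and the one from the additional vertex.
    have h : (-1 : F) ^ ((n + m) % 2) * (-1) ^ n * (-1) ^ m = 1 := by
      rw [← neg_one_pow_eq_pow_mod_two, mul_assoc, ← pow_add, ← pow_add]
      exact (Even.add_self _).neg_one_pow
    linear_combination ((∏ k, ∑ b : Bool, if Compatible φ U k b then (1 : F) else 0) *
        ∏ j, if ∃ i, U (j, i) = false then 1 else 0) * h
  · intro k
    exact coverWeight_of_src_ne φ L U _ (by simp [baseGraph]) (by simp [baseGraph])
      (by simp [baseGraph])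
  · intro z
    exact coverWeight_of_src_ne φ L U _ (by simp [baseGraph]) (by simp [baseGraph])
      (by simp [baseGraph])

theorem prod_ite_one_zero {ι R : Type*} [Fintype ι] [CommSemiring R] (p : ι → Prop)
    [DecidablePred p] [Decidable (∀ i, p i)] :
    (∏ i, if p i then (1 : R) else 0) = if ∀ i, p i then 1 else 0 := by
  split_ifs with h
  · exact Finset.prod_eq_one fun i _ => if_pos (h i)
  · push Not at h
    obtain ⟨i, hi⟩ := h
    exact Finset.prod_eq_zero (Finset.mem_univ i) (if_neg hi)

/-- Expanding the product over the variables, the sides traversed form an assignment `α`. Exactly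
one `U` is compatible with it: true instances use the variable edge, false ones the clause edge. The
clause factors then test satisfaction. A variable without instances allows both sides, as the count
requires. -/
theorem sum_det_baseMatrix :
    ∑ U, (φ.baseMatrix L (coverWeight F φ L U)).det = (φ.numSat : F) := by
  simp only [det_baseMatrix_coverWeight, Fintype.prod_sum, Finset.sum_mul]
  rw [Finset.sum_comm, numSat, Fintype.card_subtype, Finset.cast_card, Finset.sum_filter]
  refine Finset.sum_congr rfl fun α _ => ?_
  have h : ∀ U, (∏ k, if Compatible φ U k (α k) then (1 : F) else 0) =
      if U = fun p => ((φ p.1 p.2).2 != α (φ p.1 p.2).1) then 1 else 0 := by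
    intro U
    rw [prod_ite_one_zero]
    refine if_congr ⟨fun h => funext fun p => h _ p rfl, ?_⟩ rfl rfl
    rintro rfl k p rfl
    rfl
  simp only [h]
  rw [Fintype.sum_eq_single (fun p => ((φ p.1 p.2).2 != α (φ p.1 p.2).1))
    (fun U hU => by rw [if_neg hU, zero_mul]), if_pos rfl, one_mul, prod_ite_one_zero]
  refine if_congr (forall_congr' fun j => exists_congr fun i => ?_) rfl rfl
  rw [bne_eq_false_iff_eq]
  exact eq_comm

theorem coverMatrix_eq (T : Fin m × Fin 3 → Bool) :
    coverMatrix (φ.baseGraph F L).src (φ.baseGraph F L).tgt (edgeWeight F φ) (φ.firstEdge L)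
      (φ.secondEdge L) T =
    φ.baseMatrix L (coverWeight F φ L fun p => if L.clauseFirst p then T p else !T p) := by
  have h1 : (fun p => if T p then φ.firstEdge L p else φ.secondEdge L p) =
      φ.usedEdge L fun p => if L.clauseFirst p then T p else !T p := by
    funext p
    simp only [firstEdge, secondEdge, usedEdge]
    by_cases h1 : T p = true <;> by_cases h2 : L.clauseFirst p = true <;>
      simp [h1, h2, clauseEdge, variableEdge]
  have h2 : (fun p => if T p then φ.secondEdge L p else φ.firstEdge L p) =
      φ.unusedEdge L fun p => if L.clauseFirst p then T p else !T p := by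
    funext p
    simp only [firstEdge, secondEdge, unusedEdge]
    by_cases h1 : T p = true <;> by_cases h2 : L.clauseFirst p = true <;>
      simp [h1, h2, clauseEdge, variableEdge]
  rw [coverMatrix, h1, h2]
  rfl

theorem sum_det_coverMatrix :
    ∑ T, (coverMatrix (φ.baseGraph F L).src (φ.baseGraph F L).tgt (edgeWeight F φ) (φ.firstEdge L)
      (φ.secondEdge L) T).det = (φ.numSat : F) := by
  simp only [coverMatrix_eq]
  rw [← sum_det_baseMatrix φ L]
  -- `T` distinguishes first and second edges, `U` clause and variable edges; passing from one to
  -- the other flips fixed coordinates, so it only reindexes the sum.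
  have hinv : Function.Involutive fun (T : Fin m × Fin 3 → Bool) p =>
      if L.clauseFirst p then T p else !T p := by
    intro T
    funext p
    cases h : L.clauseFirst p <;> simp [h]
  exact Equiv.sum_comp hinv.toPerm fun U => (φ.baseMatrix L (coverWeight F φ L U)).det

theorem variableEdge_injective : Function.Injective (variableEdge φ L) := by
  intro p q h
  refine L.slot_injective ?_
  simp only [variableEdge, BaseEdge.varExt.injEq] at h
  exact Sigma.ext h.1 h.2

theorem clauseEdge_injective : Function.Injective (clauseEdge φ) := by
  rintro ⟨j, i⟩ ⟨j', i'⟩ h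
  simpa [clauseEdge] using h

theorem firstEdge_injective : Function.Injective (φ.firstEdge L) := by
  intro p q h
  simp only [firstEdge] at h
  split_ifs at h
  · exact clauseEdge_injective φ h
  · exact variableEdge_injective φ L h

theorem secondEdge_injective : Function.Injective (φ.secondEdge L) := by
  intro p q h
  simp only [secondEdge] at h
  split_ifs at h
  · exact variableEdge_injective φ L h
  · exact clauseEdge_injective φ h

theorem firstEdge_ne_secondEdge (p q : Fin m × Fin 3) : φ.firstEdge L p ≠ φ.secondEdge L q := by
  intro h
  simp only [firstEdge, secondEdge] at h
  split_ifs at h with h1 h2 h2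
  · rw [clauseEdge_injective φ h] at h1
    exact h2 h1
  · rw [variableEdge_injective φ L h] at h1
    exact h1 h2

theorem tgt_varExt_ne_clause (l : Fin n × Bool) (i : Fin (φ.sideLen l + 1)) (j : Fin m)
    (c : Fin 4) : (φ.baseGraph F L).tgt (.varExt l i) ≠ .clause j c := by
  intro h
  have h1 := component_pathVertex φ l (i + 1)
  change component φ ((φ.baseGraph F L).tgt (.varExt l i)) = _ at h1
  rw [h] at h1
  cases h1

theorem tgt_firstEdge_ne (p : Fin m × Fin 3) :
    (φ.baseGraph F L).tgt (φ.firstEdge L p) ≠ (φ.baseGraph F L).tgt (φ.secondEdge L p) := by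
  rw [firstEdge, secondEdge]
  split_ifs
  · exact (tgt_varExt_ne_clause φ L _ _ _ _).symm
  · exact tgt_varExt_ne_clause φ L _ _ _ _

end ThreeSAT

theorem mainTheorem2 {F : Type*} [Field F] {n m : ℕ} (φ : ThreeSAT n m)
    (L : ThreeSAT.Layout φ) {N : ℕ} (e : ThreeSAT.HVertex φ ≃ Fin N) (he : φ.IsNumbering e) :
    ∃ a b : F,
      cayleyDet (Matrix.reindex e e (φ.hGraph F L).adjacency) = a • (1 : M2 F) + b • matJ F ∧
      a + b = 4 ^ (3 * m) * (φ.numSat : F) := by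
  have key := isJSum_cayleyDet_xorReplace (φ.baseGraph F L) (φ.firstEdge L) (φ.secondEdge L)
    (φ.edgeWeight F) ?_ (φ.firstEdge_injective L) (φ.secondEdge_injective L)
    (φ.firstEdge_ne_secondEdge L) (φ.tgt_firstEdge_ne L) ?_ ?_ e he.base_lt he.consecutive
  · rw [φ.sum_det_coverMatrix L, Fintype.card_prod, Fintype.card_fin, Fintype.card_fin,
      mul_comm m 3] at key
    exact key
  · intro e
    cases e <;> simp [ThreeSAT.baseGraph, ThreeSAT.edgeWeight]
  · intro p
    rw [ThreeSAT.firstEdge]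
    split_ifs <;> rfl
  · intro p
    rw [ThreeSAT.secondEdge]
    split_ifs <;> rfl
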